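/- Let $p>1$, $a,b\in\mathbb R$, $R>1$, and write $\langle x\rangle=(1+x^2)^{1/2}$. Let $f\in C^2(\mathbb R)$ satisfy $\operatorname{supp} f\subset\{|x|\le R\}$, $f\ge 0$ and $f\not\equiv 0$. For $\varepsilon>0$ consider the Cauchy problem $$u_{tt}-u_{xx}=\langle t+\langle x\rangle\rangle^{-(1+a)}\langle t-\langle x\rangle\rangle^{-(1+b)}|u|^p,\qquad u(x,0)=\varepsilon f(x),\quad u_t(x,0)=0 .$$ Then there exist constants $\varepsilon_5>0$ and $C>0$, depending only on $f,p,a,b,R$ (in particular not on $\varepsilon$), such that for every $0<\varepsilon\le\varepsilon_5$ the problem has no classical solution $u\in C^2(\mathbb R\times[0,T))$ whenever $T$ satisfies $$T\ge\begin{cases} \exp(C\varepsilon^{-(p-1)}) & \text{if } a=0,\ b>0,\\ \exp(C\varepsilon^{-p(p-1)}) & \text{if } a+b=0,\ a>0,\\ \exp(C\varepsilon^{-p(p-1)/(p+1)}) & \text{if } a=b=0,\\ C\varepsilon^{-(p-1)/(-a)} & \text{if } a<0,\ b>0,\\ \psi_1^{-1}(C\varepsilon^{-p(p-1)}) & \text{if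 } a<0,\ b=0,\\ C\varepsilon^{-p(p-1)/(-pa-b)} & \text{if } a<0,\ b<0,\\ \psi_2^{-1}(C\varepsilon^{-p(p-1)}) & \text{if } a=0,\ b<0,\\ C\varepsilon^{-p(p-1)/(-a-b)} & \text{if } a+b<0,\ a>0, \end{cases}$$ where $\psi_1^{-1}$ and $\psi_2^{-1}$ are the inverse functions on $[0,\infty)$ of $\psi_1(s)=s^{-pa}\log(2+s)$ (for $a<0$) and $\psi_2(s)=s^{-b}(\log(2+s))^{p-1}$ (for $b<0$). -/

import Mathlib

/-- The Japanese bracket `⟨x⟩ = (1 + x²)^{1/2}`. -/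
noncomputable def japaneseBracket (x : ℝ) : ℝ := Real.sqrt (1 + x ^ 2)

/-- The characteristic weight `F(x,t) = ⟨t + ⟨x⟩⟩^{-(1+a)} ⟨t - ⟨x⟩⟩^{-(1+b)}`. -/
noncomputable def charWeight (a b x t : ℝ) : ℝ :=
  japaneseBracket (t + japaneseBracket x) ^ (-(1 + a)) *
    japaneseBracket (t - japaneseBracket x) ^ (-(1 + b))

/-- `u = u(x,t)` is a classical solution on `ℝ × [0,T)` of
`u_tt - u_xx = F(x,t) |u|^p`, `u(x,0) = ε f(x)`, `u_t(x,0) = ε g(x)`: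
it is `C²` on `ℝ × [0,T)` (up to the boundary `t = 0`), the equation holds for `0 < t < T`,
and the initial conditions hold at `t = 0` (where `u_t` is the one-sided derivative). -/
structure IsClassicalSolution (p a b ε : ℝ) (f g : ℝ → ℝ) (T : ℝ) (u : ℝ × ℝ → ℝ) : Prop where
  contDiffOn : ContDiffOn ℝ 2 u (Set.univ ×ˢ Set.Ico 0 T)
  wave_eq : ∀ x t : ℝ, 0 < t → t < T →
    iteratedDeriv 2 (fun s => u (x, s)) t - iteratedDeriv 2 (fun y => u (y, t)) x
      = charWeight a b x t * |u (x, t)| ^ p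
  init_value : ∀ x : ℝ, u (x, 0) = ε * f x
  init_speed : ∀ x : ℝ, HasDerivWithinAt (fun t => u (x, t)) (ε * g x) (Set.Ici 0) 0

/-- `ψ₁(s) = s^{-pa} log(2+s)`. -/
noncomputable def psi1 (p a s : ℝ) : ℝ := s ^ (-(p * a)) * Real.log (2 + s)

/-- `ψ₂(s) = s^{-b} log^{p-1}(2+s)`. -/
noncomputable def psi2 (p b s : ℝ) : ℝ := s ^ (-b) * Real.log (2 + s) ^ (p - 1)

/-- For positive exponents `c`, `d` the function `s^c log^d(2+s)` is a bijection of `[0,∞)`. -/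
theorem bijOn_rpow_mul_log {c d : ℝ} (hc : 0 < c) (hd : 0 < d) :
    Set.BijOn (fun s : ℝ => s ^ c * Real.log (2 + s) ^ d) (Set.Ici 0) (Set.Ici 0) := by
  have hlog : ∀ s : ℝ, 0 ≤ s → 0 < Real.log (2 + s) := fun s hs =>
    Real.log_pos (by linarith)
  refine ⟨?_, ?_, ?_⟩
  · intro s hs
    have hs : (0 : ℝ) ≤ s := hs
    have := hlog s hs
    show (0 : ℝ) ≤ _
    positivity
  · apply StrictMonoOn.injOn
    intro x hx y hy hxy
    have hx : (0 : ℝ) ≤ x := hx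
    have hlx := hlog x hx
    have h1 : x ^ c < y ^ c := Real.rpow_lt_rpow hx hxy hc
    have h2 : Real.log (2 + x) ^ d ≤ Real.log (2 + y) ^ d :=
      Real.rpow_le_rpow hlx.le (Real.log_le_log (by linarith) (by linarith)) hd.le
    exact mul_lt_mul h1 h2 (Real.rpow_pos_of_pos hlx _) (Real.rpow_nonneg (hx.trans hxy.le) _)
  · have hcont : ContinuousOn (fun s : ℝ => s ^ c * Real.log (2 + s) ^ d) (Set.Ici 0) := by
      apply ContinuousOn.mul
      · exact (Real.continuous_rpow_const hc.le).continuousOn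
      · apply ContinuousOn.rpow_const
        · apply ContinuousOn.log
          · fun_prop
          · intro s hs
            have hs : (0 : ℝ) ≤ s := hs
            linarith
        · intro s _
          exact Or.inr hd.le
    have htend : Filter.Tendsto (fun s : ℝ => s ^ c * Real.log (2 + s) ^ d)
        Filter.atTop Filter.atTop := by
      apply Filter.Tendsto.atTop_mul_atTop₀ (tendsto_rpow_atTop hc)
      exact (tendsto_rpow_atTop hd).comp (Real.tendsto_log_atTop.comp
        (Filter.tendsto_atTop_add_const_left _ _ Filter.tendsto_id))
    intro y hy
    have hy : (0 : ℝ) ≤ y := hy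
    obtain ⟨N, hN⟩ := ((htend.eventually_ge_atTop y).and (Filter.eventually_ge_atTop 0)).exists
    have := intermediate_value_Icc hN.2 (hcont.mono Set.Icc_subset_Ici_self)
    obtain ⟨s, hs, rfl⟩ := this ⟨by simpa [Real.zero_rpow hc.ne'] using hy, hN.1⟩
    exact ⟨s, hs.1, rfl⟩

/-- For `a < 0` the function `ψ₁` is a bijection of `[0,∞)`. -/
theorem bijOn_psi1 {p a : ℝ} (hp : 1 < p) (ha : a < 0) :
    Set.BijOn (psi1 p a) (Set.Ici 0) (Set.Ici 0) := by
  have h := bijOn_rpow_mul_log (c := -(p * a)) (d := 1) (by nlinarith) one_pos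
  simp only [Real.rpow_one] at h
  exact h

/-- For `b < 0` the function `ψ₂` is a bijection of `[0,∞)`. -/
theorem bijOn_psi2 {p b : ℝ} (hp : 1 < p) (hb : b < 0) :
    Set.BijOn (psi2 p b) (Set.Ici 0) (Set.Ici 0) :=
  bijOn_rpow_mul_log (c := -b) (d := p - 1) (by linarith) (by linarith)

/-- `ψ₁⁻¹`, the inverse of `ψ₁` as a function on `[0,∞)` (it is used only for `a < 0`). -/
noncomputable def psi1Inv (p a : ℝ) : ℝ → ℝ := Function.invFunOn (psi1 p a) (Set.Ici 0)

/-- `ψ₂⁻¹`, the inverse of `ψ₂` as a function on `[0,∞)` (it is used only for `b < 0`). -/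
noncomputable def psi2Inv (p b : ℝ) : ℝ → ℝ := Function.invFunOn (psi2 p b) (Set.Ici 0)

/-! In the null coordinates ξ = t + x, η = t - x the equation reads 4 w_ξη = F |w|^p with F ≥ 0.
Zero initial speed gives w_ξ = ε f'(ξ)/2 on the initial line ξ + η = 0, so w dominates the free
solution ε (f(ξ) + f(-η))/2, and every characteristic rectangle in the past of a point adds the
integral of its source to the value there.

For ξ ≥ K the term f(ξ) vanishes. On a strip of η where f(-η) stays away from zero, w ≥ δε, while F
is at least of order ξ^(-(1+a)) there. In the region K ≤ η ≤ ξ, F is at least of order ξ^(-(1+a))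
η^(-(1+b)). These facts are collected in `NullGain`; the rest is scalar analysis. Write P_a for
`rpowPrimitive a`.

The main tool is `rectangle_bound`: if w ≥ m on a rectangle, then m^(p-1) ΔΦ ΔΨ is bounded, for
otherwise repeated use of the gain makes w infinite at the upper corner. In the strip, with m = δε,
this bounds ε^(p-1) P_a(T) and settles b > 0, a ≤ 0. For the interior, the source in the strip first
yields w ≥ c ε^p A with A = P_a(ξ₀) - P_a(K), and `rectangle_bound` on [ξ₀, ξ₁] × [K, ξ₀] gives
A^(p-1) B D < C ε^(-p(p-1)), where B and D are the increments of P_a and P_b over its sides. The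
scales ξ₀ = T/2, ξ₁ = T (or ξ₀ = √T if a = b = 0) give all remaining cases but one.

In the exceptional case a + b = 0, a > 0, one rectangle gains only a constant. Each scale N, 4N,
16N, ... raises a bound μ to μ + cμ^p, so μ^(-(p-1)) falls by a fixed amount per scale. It starts at
order ε^(-p(p-1)) and stays positive, which limits the number of scales and hence log T
(`exists_scale_invariant_bound`). -/

open Set

/-! ### The wave equation along characteristics -/

/-- The derivative `∂w/∂ξ` of `w(ξ, η) = u((ξ - η)/2, (ξ + η)/2)`, taken within the strip
`0 ≤ t < T`. -/
noncomputable def nullSlope (T : ℝ) (u : ℝ × ℝ → ℝ) (ξ η : ℝ) : ℝ :=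
  fderivWithin ℝ u (univ ×ˢ Ico 0 T) ((ξ - η) / 2, (ξ + η) / 2) (1 / 2, 1 / 2)

lemma uniqueDiffOn_univ_prod_Ico (T : ℝ) :
    UniqueDiffOn ℝ ((univ : Set ℝ) ×ˢ Ico (0 : ℝ) T) :=
  uniqueDiffOn_univ.prod (uniqueDiffOn_Ico 0 T)

lemma hasDerivWithinAt_nullSlope {T : ℝ} {u : ℝ × ℝ → ℝ}
    (hu : ContDiffOn ℝ 2 u (univ ×ˢ Ico 0 T)) {ξ η : ℝ} (h0 : 0 ≤ ξ + η) (hT : ξ + η < 2 * T) :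
    HasDerivWithinAt (fun x => u ((x - η) / 2, (x + η) / 2)) (nullSlope T u ξ η)
      (Ico (-η) (2 * T - η)) ξ := by
  have h1 : HasFDerivWithinAt u
      (fderivWithin ℝ u (univ ×ˢ Ico 0 T) ((ξ - η) / 2, (ξ + η) / 2)) (univ ×ˢ Ico 0 T)
      ((ξ - η) / 2, (ξ + η) / 2) := by
    refine (hu.differentiableOn (by norm_num) _ ?_).hasFDerivWithinAt
    simp only [mem_prod, mem_univ, mem_Ico, true_and]
    constructor <;> linarith
  have h2 : HasDerivWithinAt (fun x : ℝ => ((x - η) / 2, (x + η) / 2))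
      ((1 / 2 : ℝ), (1 / 2 : ℝ)) (Ico (-η) (2 * T - η)) ξ := by
    apply HasDerivWithinAt.prodMk
    · exact ((hasDerivWithinAt_id _ _).sub_const _).div_const _
    · exact ((hasDerivWithinAt_id _ _).add_const _).div_const _
  refine h1.comp_hasDerivWithinAt (f := fun x : ℝ => ((x - η) / 2, (x + η) / 2)) ξ h2 ?_
  intro x hx
  simp only [mem_Ico] at hx
  simp only [mem_prod, mem_univ, mem_Ico, true_and]
  constructor <;> linarith

/-- Continuity up to t = 0 is what links the initial slope to the interior, where the equation
holds. -/
lemma continuousOn_nullSlope {T : ℝ} {u : ℝ × ℝ → ℝ}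
    (hu : ContDiffOn ℝ 2 u (univ ×ˢ Ico 0 T)) (ξ : ℝ) :
    ContinuousOn (nullSlope T u ξ) (Ico (-ξ) (2 * T - ξ)) := by
  have h1 : ContinuousOn (fderivWithin ℝ u (univ ×ˢ Ico 0 T)) (univ ×ˢ Ico 0 T) :=
    hu.continuousOn_fderivWithin (uniqueDiffOn_univ_prod_Ico T) (by norm_num)
  have h2 : ContinuousOn (fun y : ℝ =>
      fderivWithin ℝ u (univ ×ˢ Ico 0 T) ((ξ - y) / 2, (ξ + y) / 2)) (Ico (-ξ) (2 * T - ξ)) := by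
    refine h1.comp (f := fun y : ℝ => ((ξ - y) / 2, (ξ + y) / 2)) (by fun_prop) ?_
    intro x hx
    simp only [mem_Ico] at hx
    simp only [mem_prod, mem_univ, mem_Ico, true_and]
    constructor <;> linarith
  exact h2.clm_apply continuousOn_const

/-- ∂_ξ = (∂_x + ∂_t)/2, and the time part drops out because the initial speed is zero. -/
lemma nullSlope_initial {p a b ε T : ℝ} {f : ℝ → ℝ} {u : ℝ × ℝ → ℝ}
    (h : IsClassicalSolution p a b ε f (fun _ => 0) T u) (hf : Differentiable ℝ f) (hT : 0 < T)
    (ξ : ℝ) : nullSlope T u ξ (-ξ) = ε / 2 * deriv f ξ := by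
  have hmem : ((ξ, 0) : ℝ × ℝ) ∈ (univ : Set ℝ) ×ˢ Ico (0 : ℝ) T := by simp [hT]
  have h1 := (h.contDiffOn.differentiableOn (by norm_num) _ hmem).hasFDerivWithinAt
  have hx : HasDerivAt (fun y => u (y, 0))
      (fderivWithin ℝ u (univ ×ˢ Ico 0 T) (ξ, 0) (1, 0)) ξ := by
    rw [← hasDerivWithinAt_univ]
    refine h1.comp_hasDerivWithinAt (f := fun y : ℝ => (y, (0 : ℝ))) ξ
      ((hasDerivWithinAt_id _ _).prodMk (hasDerivWithinAt_const _ _ _)) ?_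
    intro y _
    simp [hT]
  have ht : HasDerivWithinAt (fun s => u (ξ, s))
      (fderivWithin ℝ u (univ ×ˢ Ico 0 T) (ξ, 0) (0, 1)) (Ico 0 T) 0 := by
    refine h1.comp_hasDerivWithinAt (f := fun s : ℝ => (ξ, s)) 0
      ((hasDerivWithinAt_const _ _ _).prodMk (hasDerivWithinAt_id _ _)) ?_
    intro y hy
    simpa using hy
  have ex : fderivWithin ℝ u (univ ×ˢ Ico 0 T) (ξ, 0) (1, 0) = ε * deriv f ξ := by
    simp only [h.init_value] at hx
    exact hx.unique ((hf ξ).hasDerivAt.const_mul ε)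
  have et : fderivWithin ℝ u (univ ×ˢ Ico 0 T) (ξ, 0) (0, 1) = 0 := by
    have := (h.init_speed ξ).mono (show Ico 0 T ⊆ Ici 0 from Ico_subset_Ici_self)
    simp only [mul_zero] at this
    exact (uniqueDiffOn_Ico 0 T 0 (by simp [hT])).eq_deriv _ ht this
  have e : ((1 / 2 : ℝ), (1 / 2 : ℝ)) = (1 / 2 : ℝ) • ((1, 0) : ℝ × ℝ) + (1 / 2 : ℝ) • (0, 1) := by
    simp
  unfold nullSlope
  rw [show (ξ - -ξ) / 2 = ξ by ring, show (ξ + -ξ) / 2 = 0 by ring, e, map_add, map_smul, map_smul,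
    ex, et]
  simp only [smul_eq_mul]
  ring

/-- The pure second derivative along a line is the diagonal value of the second derivative. -/
lemma iteratedDeriv_two_line {u : ℝ × ℝ → ℝ} {q v : ℝ × ℝ} (hu : ContDiffAt ℝ 2 u q)
    {γ : ℝ → ℝ × ℝ} {s : ℝ} (hγ : ∀ r, HasDerivAt γ v r) (hq : γ s = q) :
    iteratedDeriv 2 (fun r => u (γ r)) s = fderiv ℝ (fderiv ℝ u) q v v := by
  subst hq
  have hev : ∀ᶠ r in nhds s, deriv (fun r => u (γ r)) r = fderiv ℝ u (γ r) v := by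
    have h1 : ∀ᶠ x in nhds (γ s), ContDiffAt ℝ 2 u x := hu.eventually (by simp)
    filter_upwards [(hγ s).continuousAt.eventually h1] with r hr
    exact ((hr.differentiableAt (by norm_num)).hasFDerivAt.comp_hasDerivAt r (hγ r)).deriv
  rw [iteratedDeriv_succ, iteratedDeriv_one, Filter.EventuallyEq.deriv_eq hev]
  have h2 : HasFDerivAt (fderiv ℝ u) (fderiv ℝ (fderiv ℝ u) (γ s)) (γ s) :=
    ((hu.fderiv_right (m := 1) (by norm_num)).differentiableAt (by norm_num)).hasFDerivAt
  have h3 := (h2.comp_hasDerivAt s (hγ s)).clm_apply (hasDerivAt_const s v)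
  simpa using h3.deriv

/-- This is the factorisation 4 ∂_η ∂_ξ = ∂_t² - ∂_x² for a Hessian; symmetry cancels the mixed
terms. -/
lemma bilin_null_eq (L : ℝ × ℝ →L[ℝ] ℝ × ℝ →L[ℝ] ℝ) (h : L (1, 0) (0, 1) = L (0, 1) (1, 0)) :
    4 * L (-1 / 2, 1 / 2) (1 / 2, 1 / 2) = L (0, 1) (0, 1) - L (1, 0) (1, 0) := by
  have e1 : ((1 / 2 : ℝ), (1 / 2 : ℝ)) = (1 / 2 : ℝ) • ((1, 0) : ℝ × ℝ) + (1 / 2 : ℝ) • (0, 1) := by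
    simp
  have e2 : ((-1 / 2 : ℝ), (1 / 2 : ℝ)) =
      (-1 / 2 : ℝ) • ((1, 0) : ℝ × ℝ) + (1 / 2 : ℝ) • (0, 1) := by
    simp
  rw [e1, e2]
  simp only [map_add, map_smul, add_apply, smul_apply,
    smul_eq_mul, h]
  ring

lemma IsClassicalSolution.fderiv_fderiv_null {p a b ε T : ℝ} {f g : ℝ → ℝ} {u : ℝ × ℝ → ℝ}
    (h : IsClassicalSolution p a b ε f g T u) {x t : ℝ} (h0 : 0 < t) (hT : t < T)
    (hu : ContDiffAt ℝ 2 u (x, t)) :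
    4 * fderiv ℝ (fderiv ℝ u) (x, t) (-1 / 2, 1 / 2) (1 / 2, 1 / 2) =
      charWeight a b x t * |u (x, t)| ^ p := by
  have hsymm : IsSymmSndFDerivAt ℝ u (x, t) := hu.isSymmSndFDerivAt (by simp)
  have ht := iteratedDeriv_two_line (γ := fun s => (x, s)) (v := (0, 1)) (s := t) hu
    (fun r => (hasDerivAt_const _ _).prodMk (hasDerivAt_id _)) rfl
  have hx := iteratedDeriv_two_line (γ := fun s => (s, t)) (v := (1, 0)) (s := x) hu
    (fun r => (hasDerivAt_id _).prodMk (hasDerivAt_const _ _)) rfl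
  rw [bilin_null_eq _ (hsymm (1, 0) (0, 1)), ← ht, ← hx]
  exact h.wave_eq x t h0 hT

lemma univ_prod_Ico_mem_nhds {T : ℝ} {q : ℝ × ℝ} (h0 : 0 < q.2) (hT : q.2 < T) :
    (univ : Set ℝ) ×ˢ Ico (0 : ℝ) T ∈ nhds q := by
  rw [nhds_prod_eq]
  exact Filter.prod_mem_prod Filter.univ_mem (Ico_mem_nhds h0 hT)

lemma hasDerivAt_nullSlope {p a b ε T : ℝ} {f g : ℝ → ℝ} {u : ℝ × ℝ → ℝ}
    (h : IsClassicalSolution p a b ε f g T u) {ξ η : ℝ} (h0 : 0 < ξ + η) (hT : ξ + η < 2 * T) :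
    HasDerivAt (nullSlope T u ξ)
      (1 / 4 * (charWeight a b ((ξ - η) / 2) ((ξ + η) / 2) *
        |u ((ξ - η) / 2, (ξ + η) / 2)| ^ p)) η := by
  have hq1 : 0 < (ξ + η) / 2 := by linarith
  have hq2 : (ξ + η) / 2 < T := by linarith
  have hu : ContDiffAt ℝ 2 u ((ξ - η) / 2, (ξ + η) / 2) :=
    h.contDiffOn.contDiffAt (univ_prod_Ico_mem_nhds hq1 hq2)
  have hline : HasDerivAt (fun y : ℝ => ((ξ - y) / 2, (ξ + y) / 2))
      ((-1 / 2 : ℝ), (1 / 2 : ℝ)) η := by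
    apply HasDerivAt.prodMk
    · exact ((hasDerivAt_id η).const_sub ξ).div_const 2
    · exact ((hasDerivAt_id η).const_add ξ).div_const 2
  have h2 : HasFDerivAt (fderiv ℝ u)
      (fderiv ℝ (fderiv ℝ u) ((ξ - η) / 2, (ξ + η) / 2)) ((ξ - η) / 2, (ξ + η) / 2) :=
    ((hu.fderiv_right (m := 1) (by norm_num)).differentiableAt (by norm_num)).hasFDerivAt
  have h3 : HasDerivAt (fun y : ℝ => fderiv ℝ u ((ξ - y) / 2, (ξ + y) / 2))
      (fderiv ℝ (fderiv ℝ u) ((ξ - η) / 2, (ξ + η) / 2) (-1 / 2, 1 / 2)) η :=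
    h2.comp_hasDerivAt (f := fun y : ℝ => ((ξ - y) / 2, (ξ + y) / 2)) η hline
  have h4 := h3.clm_apply (hasDerivAt_const η ((1 / 2 : ℝ), (1 / 2 : ℝ)))
  rw [map_zero, add_zero] at h4
  rw [← h.fderiv_fderiv_null hq1 hq2 hu]
  -- At interior points the derivative within the strip is the full derivative, and this persists
  -- nearby.
  refine HasDerivAt.congr_of_eventuallyEq (h4.congr_deriv (by ring)) ?_
  have hs : 0 < ξ + η ∧ ξ + η < 2 * T := ⟨h0, hT⟩
  have hev : ∀ᶠ y in nhds η, 0 < ξ + y ∧ ξ + y < 2 * T :=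
    ((continuous_const.add continuous_id).isOpen_preimage _ isOpen_Ioo).mem_nhds hs
  filter_upwards [hev] with y hy
  have hm : (univ : Set ℝ) ×ˢ Ico (0 : ℝ) T ∈ nhds ((ξ - y) / 2, (ξ + y) / 2) :=
    univ_prod_Ico_mem_nhds (by simp only; linarith) (by simp only; linarith)
  unfold nullSlope
  rw [fderivWithin_of_mem_nhds hm]

/-- Monotonicity of f - g replaces integration: sources are compared with explicit primitives, so no
integrals appear. -/
lemma sub_le_sub_of_hasDerivAt_le {f g f' g' : ℝ → ℝ} {x y : ℝ} (hxy : x ≤ y)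
    (hfc : ContinuousOn f (Icc x y)) (hgc : ContinuousOn g (Icc x y))
    (hf : ∀ s ∈ Ioo x y, HasDerivAt f (f' s) s) (hg : ∀ s ∈ Ioo x y, HasDerivAt g (g' s) s)
    (h : ∀ s ∈ Ioo x y, g' s ≤ f' s) : g y - g x ≤ f y - f x := by
  have hd : ∀ s ∈ interior (Icc x y), HasDerivAt (fun s => f s - g s) (f' s - g' s) s := by
    intro s hs
    rw [interior_Icc] at hs
    exact (hf s hs).sub (hg s hs)
  have hm : MonotoneOn (fun s => f s - g s) (Icc x y) := by
    refine monotoneOn_of_deriv_nonneg (convex_Icc x y) (hfc.sub hgc)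
      (fun s hs => (hd s hs).differentiableAt.differentiableWithinAt) fun s hs => ?_
    rw [(hd s hs).deriv]
    rw [interior_Icc] at hs
    linarith [h s hs]
  have := hm (left_mem_Icc.2 hxy) (right_mem_Icc.2 hxy) hxy
  simp only at this
  linarith

/-! ### Brackets and the weight in null coordinates -/

lemma one_le_japaneseBracket (x : ℝ) : 1 ≤ japaneseBracket x := by
  rw [japaneseBracket, Real.one_le_sqrt]
  nlinarith [sq_nonneg x]

lemma abs_le_japaneseBracket (x : ℝ) : |x| ≤ japaneseBracket x := by
  rw [japaneseBracket]
  exact Real.abs_le_sqrt (by linarith)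

lemma japaneseBracket_le (x : ℝ) : japaneseBracket x ≤ 1 + |x| := by
  rw [japaneseBracket, Real.sqrt_le_left (by positivity)]
  nlinarith [sq_abs x, abs_nonneg x]

lemma charWeight_nonneg (a b x t : ℝ) : 0 ≤ charWeight a b x t :=
  mul_nonneg (Real.rpow_nonneg (zero_le_one.trans (one_le_japaneseBracket _)) _)
    (Real.rpow_nonneg (zero_le_one.trans (one_le_japaneseBracket _)) _)

/-- A function in null coordinates `ξ = t + x`, `η = t - x`. -/
noncomputable def nullCoord (u : ℝ × ℝ → ℝ) (ξ η : ℝ) : ℝ := u ((ξ - η) / 2, (ξ + η) / 2)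

/-- The weight in null coordinates. -/
noncomputable def nullWeight (a b ξ η : ℝ) : ℝ := charWeight a b ((ξ - η) / 2) ((ξ + η) / 2)

/-! ### Gain from the source in characteristic rectangles -/

section gain

variable {p a b ε T : ℝ} {f : ℝ → ℝ} {u : ℝ × ℝ → ℝ}

lemma nullSlope_sub_le (h : IsClassicalSolution p a b ε f (fun _ => 0) T u)
    {ξ x y : ℝ} (hx : 0 ≤ ξ + x) (hxy : x ≤ y) (hy : ξ + y < 2 * T) {c : ℝ} {Ψ H : ℝ → ℝ}
    (hΨ : ∀ s ∈ Icc x y, HasDerivAt Ψ (H s) s)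
    (hc : ∀ s ∈ Ioo x y, c * H s ≤ 1 / 4 * (nullWeight a b ξ s * |nullCoord u ξ s| ^ p)) :
    c * (Ψ y - Ψ x) ≤ nullSlope T u ξ y - nullSlope T u ξ x := by
  have := sub_le_sub_of_hasDerivAt_le (f := nullSlope T u ξ) (g := fun s => c * Ψ s) hxy
    ((continuousOn_nullSlope h.contDiffOn ξ).mono fun s hs => ⟨by linarith [hs.1],
      by linarith [hs.2]⟩)
    (fun s hs => ((hΨ s hs).continuousAt.continuousWithinAt).const_mul c)
    (fun s hs => hasDerivAt_nullSlope h (by linarith [hs.1]) (by linarith [hs.2]))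
    (fun s hs => (hΨ s (Ioo_subset_Icc_self hs)).const_mul c) hc
  linarith

lemma nullSlope_mono (h : IsClassicalSolution p a b ε f (fun _ => 0) T u)
    {ξ x y : ℝ} (hx : 0 ≤ ξ + x) (hxy : x ≤ y) (hy : ξ + y < 2 * T) :
    nullSlope T u ξ x ≤ nullSlope T u ξ y := by
  have := nullSlope_sub_le h hx hxy hy (c := 0) (Ψ := fun _ => 0) (H := fun _ => 0)
    (fun s _ => hasDerivAt_const _ _) fun s _ => by
      have := charWeight_nonneg a b ((ξ - s) / 2) ((ξ + s) / 2)
      have hw : 0 ≤ nullWeight a b ξ s := this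
      rw [zero_mul]
      positivity
  linarith

/-- The path from the initial line η = -ξ splits at η₀ and η₁; the source is exploited only in
between, and elsewhere the slope merely does not decrease. -/
lemma nullSlope_gain (h : IsClassicalSolution p a b ε f (fun _ => 0) T u)
    (hf : Differentiable ℝ f) {ξ η₀ η₁ η : ℝ} (h0 : 0 ≤ ξ + η₀) (h01 : η₀ ≤ η₁) (h1 : η₁ ≤ η)
    (hT : ξ + η < 2 * T) {c : ℝ} {Ψ H : ℝ → ℝ}
    (hΨ : ∀ s ∈ Icc η₀ η₁, HasDerivAt Ψ (H s) s)
    (hc : ∀ s ∈ Ioo η₀ η₁, c * H s ≤ 1 / 4 * (nullWeight a b ξ s * |nullCoord u ξ s| ^ p)) :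
    ε / 2 * deriv f ξ + c * (Ψ η₁ - Ψ η₀) ≤ nullSlope T u ξ η := by
  have e1 := nullSlope_mono h (ξ := ξ) (x := -ξ) (y := η₀) (by simp) (by linarith) (by linarith)
  have e2 := nullSlope_sub_le h h0 h01 (by linarith) hΨ hc
  have e3 := nullSlope_mono h (ξ := ξ) (x := η₁) (y := η) (by linarith) h1 hT
  rw [nullSlope_initial h hf (by linarith)] at e1
  linarith

lemma nullCoord_sub_le (h : IsClassicalSolution p a b ε f (fun _ => 0) T u)
    (hf : Differentiable ℝ f) {x y η : ℝ} (hx : 0 ≤ x + η) (hxy : x ≤ y) (hT : y + η < 2 * T)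
    {d : ℝ} {Φ G : ℝ → ℝ} (hΦ : ∀ s ∈ Icc x y, HasDerivAt Φ (G s) s)
    (hd : ∀ s ∈ Ioo x y, ε / 2 * deriv f s + d * G s ≤ nullSlope T u s η) :
    ε / 2 * (f y - f x) + d * (Φ y - Φ x) ≤ nullCoord u y η - nullCoord u x η := by
  have hD : ∀ s ∈ Icc x y, HasDerivWithinAt (fun s => nullCoord u s η) (nullSlope T u s η)
      (Ico (-η) (2 * T - η)) s := fun s hs =>
    hasDerivWithinAt_nullSlope h.contDiffOn (by linarith [hs.1]) (by linarith [hs.2])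
  have hsub : Icc x y ⊆ Ico (-η) (2 * T - η) := fun s hs =>
    ⟨by linarith [hs.1], by linarith [hs.2]⟩
  have := sub_le_sub_of_hasDerivAt_le (f := fun s => nullCoord u s η)
    (g := fun s => ε / 2 * f s + d * Φ s) hxy
    (fun s hs => (hD s hs).continuousWithinAt.mono hsub)
    (fun s hs => ((hf.continuous.continuousAt.const_mul (ε / 2)).add
      ((hΦ s hs).continuousAt.const_mul d)).continuousWithinAt)
    (fun s hs => (hD s (Ioo_subset_Icc_self hs)).hasDerivAt
      (Ico_mem_nhds (by linarith [hs.1]) (by linarith [hs.2])))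
    (fun s hs => ((hf s).hasDerivAt.const_mul (ε / 2)).add
      ((hΦ s (Ioo_subset_Icc_self hs)).const_mul d)) hd
  linarith

lemma nullCoord_mono (h : IsClassicalSolution p a b ε f (fun _ => 0) T u)
    (hf : Differentiable ℝ f) {x y η : ℝ} (hx : 0 ≤ x + η) (hxy : x ≤ y) (hT : y + η < 2 * T) :
    ε / 2 * (f y - f x) ≤ nullCoord u y η - nullCoord u x η := by
  have := nullCoord_sub_le h hf hx hxy hT (d := 0) (Φ := fun _ => 0) (G := fun _ => 0)
    (fun s _ => hasDerivAt_const _ _) fun s hs => by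
      have e1 := nullSlope_mono h (ξ := s) (x := -s) (y := η) (by simp) (by linarith [hs.1])
        (by linarith [hs.2])
      rw [nullSlope_initial h hf (by linarith)] at e1
      linarith
  linarith

/-- The solution dominates the free solution. -/
lemma free_le_nullCoord (h : IsClassicalSolution p a b ε f (fun _ => 0) T u)
    (hf : Differentiable ℝ f) {ξ η : ℝ} (h0 : 0 ≤ ξ + η) (hT : ξ + η < 2 * T) :
    ε / 2 * (f ξ + f (-η)) ≤ nullCoord u ξ η := by
  have e := nullCoord_mono h hf (x := -η) (y := ξ) (η := η) (by simp) (by linarith) hT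
  have e0 : nullCoord u (-η) η = ε * f (-η) := by
    rw [nullCoord, ← h.init_value]
    congr 2 <;> ring
  rw [e0] at e
  linarith

/-- The contribution of the source in the rectangle `[ξ₀, ξ₁] × [η₀, η₁]`. -/
lemma nullCoord_gain (h : IsClassicalSolution p a b ε f (fun _ => 0) T u)
    (hf : Differentiable ℝ f) {ξ₀ ξ₁ η₀ η₁ ξ η : ℝ} (h0 : 0 ≤ ξ₀ + η₀)
    (hξ01 : ξ₀ ≤ ξ₁) (hξ1 : ξ₁ ≤ ξ) (hη01 : η₀ ≤ η₁) (hη1 : η₁ ≤ η) (hT : ξ + η < 2 * T)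
    {c : ℝ} {Φ G Ψ H : ℝ → ℝ} (hΦ : ∀ s ∈ Icc ξ₀ ξ₁, HasDerivAt Φ (G s) s)
    (hΨ : ∀ s ∈ Icc η₀ η₁, HasDerivAt Ψ (H s) s)
    (hc : ∀ x ∈ Icc ξ₀ ξ₁, ∀ y ∈ Icc η₀ η₁,
      c * G x * H y ≤ 1 / 4 * (nullWeight a b x y * |nullCoord u x y| ^ p)) :
    nullCoord u ξ₀ η + ε / 2 * (f ξ - f ξ₀) + c * (Φ ξ₁ - Φ ξ₀) * (Ψ η₁ - Ψ η₀) ≤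
      nullCoord u ξ η := by
  have e1 := nullCoord_sub_le h hf (x := ξ₀) (y := ξ₁) (η := η) (by linarith) hξ01 (by linarith)
    (d := c * (Ψ η₁ - Ψ η₀)) hΦ fun s hs => by
      have := nullSlope_gain h hf (ξ := s) (c := c * G s) (by linarith [hs.1]) hη01 hη1
        (by linarith [hs.2]) hΨ
        fun r hr => hc s (Ioo_subset_Icc_self hs) r (Ioo_subset_Icc_self hr)
      linarith
  have e2 := nullCoord_mono h hf (x := ξ₁) (y := ξ) (η := η) (by linarith) hξ1 hT
  linarith

end gain

/-! ### Iteration on a rectangle -/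

/-- Blow-up on a characteristic rectangle: a function that improves any lower bound `μ` to
`k μ ^ p ΔΦ ΔΨ` beyond each rectangle cannot start from a large lower bound. -/
lemma rectangle_bound {w : ℝ → ℝ → ℝ} {Φ Ψ : ℝ → ℝ} {ξ₀ ξ₁ η₀ η₁ k m p : ℝ} (hp : 1 < p)
    (hk : 0 < k) (hm : 0 < m) (hξ : ξ₀ ≤ ξ₁) (hη : η₀ ≤ η₁)
    (hΦc : ContinuousOn Φ (Icc ξ₀ ξ₁)) (hΨc : ContinuousOn Ψ (Icc η₀ η₁))
    (hΦm : MonotoneOn Φ (Icc ξ₀ ξ₁)) (hΨm : MonotoneOn Ψ (Icc η₀ η₁))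
    (hw : ∀ x ∈ Icc ξ₀ ξ₁, ∀ y ∈ Icc η₀ η₁, m ≤ w x y)
    (hgain : ∀ x ∈ Icc ξ₀ ξ₁, ∀ x' ∈ Icc ξ₀ ξ₁, ∀ y ∈ Icc η₀ η₁, ∀ y' ∈ Icc η₀ η₁, x ≤ x' →
      y ≤ y' → ∀ μ, 0 < μ → (∀ s ∈ Icc x ξ₁, ∀ r ∈ Icc y η₁, μ ≤ w s r) →
      ∀ s ∈ Icc x' ξ₁, ∀ r ∈ Icc y' η₁, k * μ ^ p * (Φ x' - Φ x) * (Ψ y' - Ψ y) ≤ w s r) :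
    k * m ^ (p - 1) * (Φ ξ₁ - Φ ξ₀) * (Ψ η₁ - Ψ η₀) < 4 * 4 ^ (1 / (p - 1)) := by
  by_contra! hB
  have hp' : 0 < p - 1 := by linarith
  -- The bound grows by the factor r per step. Halving both remaining increments costs a factor 4
  -- per step, which r^(p-1) = 4 compensates; a further r for growth and 4 for the first halving
  -- give the threshold 4r.
  set r : ℝ := 4 ^ (1 / (p - 1)) with hr
  have hr1 : 1 < r := Real.one_lt_rpow (by norm_num) (by positivity)
  have hr0 : 0 < r := by linarith
  have hrp : r ^ (p - 1) = 4 := by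
    rw [hr, ← Real.rpow_mul (by norm_num), one_div_mul_cancel hp'.ne', Real.rpow_one]
  have hΔΦ : 0 ≤ Φ ξ₁ - Φ ξ₀ :=
    sub_nonneg.2 (hΦm (left_mem_Icc.2 hξ) (right_mem_Icc.2 hξ) hξ)
  have hΔΨ : 0 ≤ Ψ η₁ - Ψ η₀ :=
    sub_nonneg.2 (hΨm (left_mem_Icc.2 hη) (right_mem_Icc.2 hη) hη)
  have hkm : 0 < k * m ^ (p - 1) := by positivity
  have hpos : 0 < k * m ^ (p - 1) * (Φ ξ₁ - Φ ξ₀) * (Ψ η₁ - Ψ η₀) := by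
    refine lt_of_lt_of_le ?_ hB
    positivity
  have hΔΨ' : 0 < Ψ η₁ - Ψ η₀ := hΔΨ.lt_of_ne' fun h => by simp [h] at hpos
  have hΔΦ' : 0 < Φ ξ₁ - Φ ξ₀ := hΔΦ.lt_of_ne' fun h => by simp [h] at hpos
  -- Nodes whose remaining increment to the far end is 2^(-n) of the total, found by the
  -- intermediate value theorem.
  have hpart : ∀ (F : ℝ → ℝ) (x y : ℝ), x ≤ y → ContinuousOn F (Icc x y) → 0 < F y - F x →
      ∃ s : ℕ → ℝ, ∀ n, s n ∈ Icc x y ∧ F (s n) = F x + (1 - (1 / 2) ^ n) * (F y - F x) := by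
    intro F x y hxy hF hpos
    have : ∀ n : ℕ, ∃ s ∈ Icc x y, F s = F x + (1 - (1 / 2) ^ n) * (F y - F x) := by
      intro n
      apply intermediate_value_Icc hxy hF
      have h1 : (0 : ℝ) < (1 / 2) ^ n := by positivity
      have h2 : ((1 : ℝ) / 2) ^ n ≤ 1 := pow_le_one₀ (by norm_num) (by norm_num)
      constructor <;> nlinarith
    choose s hs using this
    exact ⟨s, hs⟩
  obtain ⟨s, hs⟩ := hpart Φ ξ₀ ξ₁ hξ hΦc hΔΦ'
  obtain ⟨t, ht⟩ := hpart Ψ η₀ η₁ hη hΨc hΔΨ'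
  have hstep : ∀ n : ℕ, (1 - (1 / 2 : ℝ) ^ n) < 1 - (1 / 2) ^ (n + 1) := by
    intro n
    have h1 : (0 : ℝ) < (1 / 2) ^ n := by positivity
    rw [pow_succ]
    linarith
  have hsm : ∀ n, s n ≤ s (n + 1) := by
    intro n
    by_contra! hlt
    have := hΦm (hs _).1 (hs _).1 hlt.le
    rw [(hs _).2, (hs _).2] at this
    nlinarith [hstep n]
  have htm : ∀ n, t n ≤ t (n + 1) := by
    intro n
    by_contra! hlt
    have := hΨm (ht _).1 (ht _).1 hlt.le
    rw [(ht _).2, (ht _).2] at this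
    nlinarith [hstep n]
  have key : ∀ n : ℕ, ∀ x ∈ Icc (s n) ξ₁, ∀ y ∈ Icc (t n) η₁, m * r ^ n ≤ w x y := by
    intro n
    induction n with
    | zero =>
      intro x hx y hy
      simpa using hw x ⟨(hs 0).1.1.trans hx.1, hx.2⟩ y ⟨(ht 0).1.1.trans hy.1, hy.2⟩
    | succ n ih =>
      intro x hx y hy
      refine le_trans ?_ (hgain _ (hs n).1 _ (hs (n + 1)).1 _ (ht n).1 _ (ht (n + 1)).1 (hsm n)
        (htm n) (m * r ^ n) (by positivity) ih x hx y hy)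
      have e1 : (m * r ^ n) ^ p = m ^ (p - 1) * m * (4 ^ n * r ^ n) := by
        have h1 : (r ^ n) ^ (p - 1) = 4 ^ n := by
          rw [← hrp, ← Real.rpow_natCast, ← Real.rpow_natCast, ← Real.rpow_mul hr0.le,
            ← Real.rpow_mul hr0.le, mul_comm]
        rw [← h1, Real.rpow_sub_one hm.ne', Real.rpow_sub_one (pow_pos hr0 n).ne',
          div_mul_cancel₀ _ hm.ne', div_mul_cancel₀ _ (by positivity),
          Real.mul_rpow hm.le (by positivity)]
      rw [(hs _).2, (hs _).2, (ht _).2, (ht _).2, e1]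
      have e4 : (4 : ℝ) ^ n * ((1 / 2) ^ n * (1 / 2) ^ n) = 1 := by
        rw [← mul_pow, ← mul_pow]
        norm_num
      have e5 : k * (m ^ (p - 1) * m * (4 ^ n * r ^ n)) *
          (Φ ξ₀ + (1 - (1 / 2) ^ (n + 1)) * (Φ ξ₁ - Φ ξ₀) -
            (Φ ξ₀ + (1 - (1 / 2) ^ n) * (Φ ξ₁ - Φ ξ₀))) *
          (Ψ η₀ + (1 - (1 / 2) ^ (n + 1)) * (Ψ η₁ - Ψ η₀) -
            (Ψ η₀ + (1 - (1 / 2) ^ n) * (Ψ η₁ - Ψ η₀))) =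
          (k * m ^ (p - 1) * (Φ ξ₁ - Φ ξ₀) * (Ψ η₁ - Ψ η₀)) / 4 * (m * r ^ n) *
            (4 ^ n * ((1 / 2) ^ n * (1 / 2) ^ n)) := by
        ring
      rw [e5, e4, mul_one]
      calc m * r ^ (n + 1) = 4 * r / 4 * (m * r ^ n) := by ring
        _ ≤ _ := by gcongr
  -- The upper corner lies in every remaining rectangle, so its value would exceed m r^n for all n.
  obtain ⟨n, hn⟩ := pow_unbounded_of_one_lt (w ξ₁ η₁ / m) hr1
  have := key n ξ₁ ⟨(hs n).1.2, le_rfl⟩ η₁ ⟨(ht n).1.2, le_rfl⟩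
  rw [div_lt_iff₀ hm] at hn
  linarith

/-! ### Lower bounds for the weight -/

lemma rpow_le_mul_rpow_of_comparable {c x y : ℝ} (s : ℝ) (hc : 1 ≤ c) (hx : 0 < x)
    (hxy : x ≤ c * y) (hyx : y ≤ c * x) : c ^ (-|s|) * x ^ s ≤ y ^ s := by
  have hc0 : 0 < c := by linarith
  have hy : 0 < y := by
    by_contra! h
    nlinarith
  rcases le_total 0 s with hs | hs
  · rw [abs_of_nonneg hs, Real.rpow_neg hc0.le, inv_mul_le_iff₀ (by positivity),
      ← Real.mul_rpow hc0.le hy.le]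
    exact Real.rpow_le_rpow hx.le hxy hs
  · rw [abs_of_nonpos hs, neg_neg, ← Real.mul_rpow hc0.le hx.le]
    exact Real.rpow_le_rpow_of_nonpos hy hyx hs

/-- Since |x| ≤ ⟨x⟩ ≤ 1 + |x|, here t + ⟨x⟩ lies in [ξ, ξ + 1] and t - ⟨x⟩ in [η - 1, η]; so their
brackets are comparable to ξ and η with constant 3, whatever the signs of the exponents. -/
lemma exists_nullWeight_lower (a b : ℝ) : ∃ κ : ℝ, 0 < κ ∧ ∀ ξ η : ℝ, 1 ≤ η → η ≤ ξ →
    κ * ξ ^ (-(1 + a)) * η ^ (-(1 + b)) ≤ nullWeight a b ξ η := by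
  refine ⟨3 ^ (-|-(1 + a)|) * 3 ^ (-|-(1 + b)|), by positivity, fun ξ η hη hξ => ?_⟩
  have hx : |(ξ - η) / 2| = (ξ - η) / 2 := abs_of_nonneg (by linarith)
  have b1 := abs_le_japaneseBracket ((ξ - η) / 2)
  have b2 := japaneseBracket_le ((ξ - η) / 2)
  rw [hx] at b1 b2
  unfold nullWeight charWeight
  set X := japaneseBracket ((ξ - η) / 2)
  have c1 := abs_le_japaneseBracket ((ξ + η) / 2 + X)
  have c2 := japaneseBracket_le ((ξ + η) / 2 + X)
  rw [abs_of_nonneg (by linarith)] at c1 c2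
  have d0 := one_le_japaneseBracket ((ξ + η) / 2 - X)
  have d1 := (le_abs_self _).trans (abs_le_japaneseBracket ((ξ + η) / 2 - X))
  have d2 := japaneseBracket_le ((ξ + η) / 2 - X)
  have d3 : |(ξ + η) / 2 - X| ≤ η := abs_le.2 ⟨by linarith, by linarith⟩
  have e1 := rpow_le_mul_rpow_of_comparable (c := 3) (x := ξ)
    (y := japaneseBracket ((ξ + η) / 2 + X)) (-(1 + a)) (by norm_num) (by linarith)
    (by linarith) (by linarith)
  have e2 := rpow_le_mul_rpow_of_comparable (c := 3) (x := η)
    (y := japaneseBracket ((ξ + η) / 2 - X)) (-(1 + b)) (by norm_num) (by linarith)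
    (by linarith) (by linarith)
  have h1 : 0 ≤ ξ ^ (-(1 + a)) := Real.rpow_nonneg (by linarith) _
  have h2 : 0 ≤ η ^ (-(1 + b)) := Real.rpow_nonneg (by linarith) _
  calc _ = (3 ^ (-|-(1 + a)|) * ξ ^ (-(1 + a))) * (3 ^ (-|-(1 + b)|) * η ^ (-(1 + b))) := by ring
    _ ≤ _ := mul_le_mul e1 e2 (by positivity) (le_trans (by positivity) e1)

/-- For bounded η the second bracket stays between 1 and 3K, so its power only contributes a
constant. -/
lemma exists_nullWeight_strip_lower (a b : ℝ) {K : ℝ} (hK : 1 ≤ K) :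
    ∃ κ : ℝ, 0 < κ ∧ ∀ ξ η : ℝ, |η| ≤ K → K ≤ ξ →
      κ * ξ ^ (-(1 + a)) ≤ nullWeight a b ξ η := by
  refine ⟨3 ^ (-|-(1 + a)|) * (3 * K) ^ (-|-(1 + b)|), by positivity, fun ξ η hη hξ => ?_⟩
  obtain ⟨hη1, hη2⟩ := abs_le.1 hη
  have hx : |(ξ - η) / 2| = (ξ - η) / 2 := abs_of_nonneg (by linarith)
  have b1 := abs_le_japaneseBracket ((ξ - η) / 2)
  have b2 := japaneseBracket_le ((ξ - η) / 2)
  rw [hx] at b1 b2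
  unfold nullWeight charWeight
  set X := japaneseBracket ((ξ - η) / 2)
  have c1 := abs_le_japaneseBracket ((ξ + η) / 2 + X)
  have c2 := japaneseBracket_le ((ξ + η) / 2 + X)
  rw [abs_of_nonneg (by linarith)] at c1 c2
  have d0 := one_le_japaneseBracket ((ξ + η) / 2 - X)
  have d2 := japaneseBracket_le ((ξ + η) / 2 - X)
  have d3 : |(ξ + η) / 2 - X| ≤ K + 1 := abs_le.2 ⟨by linarith, by linarith⟩
  have e1 := rpow_le_mul_rpow_of_comparable (c := 3) (x := ξ)
    (y := japaneseBracket ((ξ + η) / 2 + X)) (-(1 + a)) (by norm_num) (by linarith)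
    (by linarith) (by linarith)
  have e2 := rpow_le_mul_rpow_of_comparable (c := 3 * K) (x := 1)
    (y := japaneseBracket ((ξ + η) / 2 - X)) (-(1 + b)) (by linarith) one_pos
    (by nlinarith) (by linarith)
  rw [Real.one_rpow, mul_one] at e2
  have h1 : 0 ≤ ξ ^ (-(1 + a)) := Real.rpow_nonneg (by linarith) _
  calc _ = (3 ^ (-|-(1 + a)|) * ξ ^ (-(1 + a))) * (3 * K) ^ (-|-(1 + b)|) := by ring
    _ ≤ _ := mul_le_mul e1 e2 (by positivity) (le_trans (by positivity) e1)

/-! ### Primitives of powers and their increments -/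

/-- A primitive of `x ↦ x ^ (-(1 + a))` on `(0, ∞)`. -/
noncomputable def rpowPrimitive (a x : ℝ) : ℝ := if a = 0 then Real.log x else x ^ (-a) / (-a)

lemma hasDerivAt_rpowPrimitive (a : ℝ) {x : ℝ} (hx : 0 < x) :
    HasDerivAt (rpowPrimitive a) (x ^ (-(1 + a))) x := by
  rcases eq_or_ne a 0 with rfl | ha
  · have : rpowPrimitive 0 = Real.log := by
      ext y
      simp [rpowPrimitive]
    rw [this, add_zero, Real.rpow_neg_one]
    exact Real.hasDerivAt_log hx.ne'
  · have : rpowPrimitive a = fun y => y ^ (-a) / (-a) := by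
      ext y
      simp [rpowPrimitive, ha]
    rw [this]
    refine ((Real.hasDerivAt_rpow_const (p := -a) (Or.inl hx.ne')).div_const (-a)).congr_deriv ?_
    rw [mul_div_cancel_left₀ _ (neg_ne_zero.2 ha)]
    congr 1
    ring

lemma monotoneOn_rpowPrimitive (a : ℝ) : MonotoneOn (rpowPrimitive a) (Ioi 0) := by
  refine monotoneOn_of_deriv_nonneg (convex_Ioi 0)
    (fun x hx => (hasDerivAt_rpowPrimitive a hx).continuousAt.continuousWithinAt) ?_ ?_
  · intro x hx
    rw [interior_Ioi] at hx
    exact (hasDerivAt_rpowPrimitive a hx).differentiableAt.differentiableWithinAt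
  · intro x hx
    rw [interior_Ioi] at hx
    rw [(hasDerivAt_rpowPrimitive a hx).deriv]
    exact Real.rpow_nonneg (le_of_lt hx) _

lemma rpowPrimitive_mono (a : ℝ) {x y : ℝ} (hx : 0 < x) (hxy : x ≤ y) :
    rpowPrimitive a x ≤ rpowPrimitive a y :=
  monotoneOn_rpowPrimitive a hx (hx.trans_le hxy) hxy

lemma rpowPrimitive_zero_sub {x y : ℝ} (hx : 0 < x) (hy : 0 < y) :
    rpowPrimitive 0 y - rpowPrimitive 0 x = Real.log (y / x) := by
  simp [rpowPrimitive, Real.log_div hy.ne' hx.ne']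

/-- Homogeneity: x ^ (-(1 + a)) integrated over [x, 2x] scales like x ^ (-a), including a = 0, where
the constant is log 2. -/
lemma exists_rpowPrimitive_doubling (a : ℝ) : ∃ d : ℝ, 0 < d ∧ ∀ x : ℝ, 0 < x →
    rpowPrimitive a (2 * x) - rpowPrimitive a x = d * x ^ (-a) := by
  rcases eq_or_ne a 0 with rfl | ha
  · refine ⟨Real.log 2, Real.log_pos (by norm_num), fun x hx => ?_⟩
    rw [rpowPrimitive_zero_sub hx (by positivity), mul_div_cancel_right₀ _ hx.ne']
    simp
  · refine ⟨(2 ^ (-a) - 1) / (-a), ?_, fun x hx => ?_⟩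
    · rcases ha.lt_or_gt with h | h
      · exact div_pos (sub_pos.2 (Real.one_lt_rpow (by norm_num) (by linarith))) (by linarith)
      · exact div_pos_of_neg_of_neg
          (sub_neg.2 (Real.rpow_lt_one_of_one_lt_of_neg (by norm_num) (by linarith)))
          (by linarith)
    · simp only [rpowPrimitive, if_neg ha]
      rw [Real.mul_rpow (by norm_num) hx.le]
      ring

lemma exists_rpowPrimitive_half (a : ℝ) : ∃ d : ℝ, 0 < d ∧ ∀ x : ℝ, 0 < x →
    rpowPrimitive a x - rpowPrimitive a (x / 2) = d * x ^ (-a) := by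
  obtain ⟨d, hd, h⟩ := exists_rpowPrimitive_doubling a
  refine ⟨d * (1 / 2) ^ (-a), by positivity, fun x hx => ?_⟩
  have := h (x / 2) (by positivity)
  rw [mul_div_cancel₀ x two_ne_zero] at this
  rw [this, div_eq_mul_one_div x 2, Real.mul_rpow hx.le (by norm_num)]
  ring

/-- For the scale `x` and `K ≤ x / 4`, the increment of the primitive over `[K, x / 2]` is at least
a multiple of `x ^ (-a)`. -/
lemma exists_le_rpowPrimitive_sub (a : ℝ) : ∃ d : ℝ, 0 < d ∧ ∀ K x : ℝ, 0 < K → 4 * K ≤ x →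
    d * x ^ (-a) ≤ rpowPrimitive a (x / 2) - rpowPrimitive a K := by
  obtain ⟨d, hd, h⟩ := exists_rpowPrimitive_half a
  refine ⟨d * (1 / 2) ^ (-a), by positivity, fun K x hK hx => ?_⟩
  have h1 := h (x / 2) (by linarith)
  have h2 := rpowPrimitive_mono a hK (show K ≤ x / 2 / 2 by linarith)
  rw [div_eq_mul_one_div x 2, Real.mul_rpow (by linarith) (by norm_num)] at h1
  rw [div_eq_mul_one_div x 2] at h2 ⊢
  linarith

/-- For x ≥ 16K² one has x/(2K) ≥ √(2 + x). -/
lemma half_log_le_rpowPrimitive_sub {K x : ℝ} (hK : 1 ≤ K) (hx : 16 * K ^ 2 ≤ x) :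
    1 / 2 * Real.log (2 + x) ≤ rpowPrimitive 0 (x / 2) - rpowPrimitive 0 K := by
  have hx0 : 16 ≤ x := by nlinarith
  have h2 : Real.log ((2 + x) ^ (1 / 2 : ℝ)) = 1 / 2 * Real.log (2 + x) :=
    Real.log_rpow (by linarith) _
  rw [rpowPrimitive_zero_sub (by linarith) (by linarith), ← h2]
  refine Real.log_le_log (by positivity) ?_
  rw [← Real.sqrt_eq_rpow]
  refine Real.sqrt_le_iff.2 ⟨by positivity, ?_⟩
  rw [div_pow, div_pow, div_div, le_div_iff₀ (by positivity)]
  nlinarith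

/-! ### The properties used for blow-up, and their verification -/

/-- The properties of a function of the null coordinates `ξ = t + x`, `η = t - x` on which the
blow-up argument rests: a lower bound of order `ε` on the strip `η₋ ≤ η ≤ η₊`, and the
contributions of the source in rectangles of the strip and of the region `K ≤ η ≤ ξ`. -/
structure NullGain (p a b K ηm ηp δ k ε T : ℝ) (w : ℝ → ℝ → ℝ) : Prop where
  strip : ∀ ξ η, K ≤ ξ → ηm ≤ η → η ≤ ηp → ξ + η < 2 * T → δ * ε ≤ w ξ η
  nonneg : ∀ ξ η, K ≤ ξ → K ≤ η → ξ + η < 2 * T → 0 ≤ w ξ η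
  strip_gain : ∀ ξ₀ ξ₁ η₀ η₁ ξ η μ, K ≤ ξ₀ → ξ₀ ≤ ξ₁ → ξ₁ ≤ ξ → ηm ≤ η₀ → η₀ ≤ η₁ → η₁ ≤ ηp →
    η₁ ≤ η → ξ + η < 2 * T → 0 < μ → (∀ x ∈ Icc ξ₀ ξ₁, ∀ y ∈ Icc η₀ η₁, μ ≤ w x y) →
    k * μ ^ p * (rpowPrimitive a ξ₁ - rpowPrimitive a ξ₀) * (η₁ - η₀) ≤ w ξ η
  gain : ∀ ξ₀ ξ₁ η₀ η₁ ξ η μ, K ≤ η₀ → η₀ ≤ η₁ → η₁ ≤ ξ₀ → ξ₀ ≤ ξ₁ → ξ₁ ≤ ξ → η₁ ≤ η →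
    ξ + η < 2 * T → 0 < μ → (∀ x ∈ Icc ξ₀ ξ₁, ∀ y ∈ Icc η₀ η₁, μ ≤ w x y) →
    w ξ₀ η + k * μ ^ p * (rpowPrimitive a ξ₁ - rpowPrimitive a ξ₀) *
      (rpowPrimitive b η₁ - rpowPrimitive b η₀) ≤ w ξ η

/-- Classical solutions with nonnegative data enjoy the properties `NullGain`. -/
lemma exists_nullGain (p a b : ℝ) {R : ℝ} (hp : 1 < p) {f : ℝ → ℝ} (hf : Differentiable ℝ f)
    (hsupp : tsupport f ⊆ {x : ℝ | |x| ≤ R}) (hf_nonneg : ∀ x, 0 ≤ f x) (hf_ne : ∃ x, f x ≠ 0) :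
    ∃ K ηm ηp δ k : ℝ, 1 ≤ K ∧ -K ≤ ηm ∧ ηm < ηp ∧ ηp ≤ K ∧ 0 < δ ∧ 0 < k ∧
      ∀ ε T : ℝ, ∀ u : ℝ × ℝ → ℝ, 0 < ε → IsClassicalSolution p a b ε f (fun _ => 0) T u →
        NullGain p a b K ηm ηp δ k ε T (nullCoord u) := by
  obtain ⟨x₀, hx₀⟩ := hf_ne
  have hfx : f x₀ / 2 < f x₀ := by
    have := (hf_nonneg x₀).lt_of_ne' hx₀
    linarith
  obtain ⟨h, hh, hball⟩ := Metric.eventually_nhds_iff.1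
    (hf.continuous.continuousAt.eventually (lt_mem_nhds hfx))
  have hstrip : ∀ η, -x₀ - h / 2 ≤ η → η ≤ -x₀ + h / 2 → f x₀ / 2 ≤ f (-η) := by
    intro η h1 h2
    refine (hball ?_).le
    rw [Real.dist_eq, abs_lt]
    constructor <;> linarith
  -- Large enough that f vanishes on [K, ∞) and the strip of width h around -x₀ lies in |η| ≤ K.
  set K := 1 + |R| + |x₀| + h with hK
  have hK1 : 1 ≤ K := by
    have := abs_nonneg R
    have := abs_nonneg x₀
    linarith
  have hfK : ∀ ξ, K ≤ ξ → f ξ = 0 := by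
    intro ξ hξ
    by_contra hne
    have h1 : |ξ| ≤ R := hsupp (subset_tsupport f hne)
    have := le_abs_self ξ
    have := le_abs_self R
    have := abs_nonneg x₀
    linarith
  obtain ⟨κ₁, hκ₁, hW₁⟩ := exists_nullWeight_lower a b
  obtain ⟨κ₂, hκ₂, hW₂⟩ := exists_nullWeight_strip_lower a b hK1
  have hlow : -K ≤ -x₀ - h / 2 := by
    have := le_abs_self x₀
    have := abs_nonneg R
    linarith
  have hupp : -x₀ + h / 2 ≤ K := by
    have := neg_abs_le x₀
    have := abs_nonneg R
    linarith
  have hk : 0 < min κ₁ κ₂ / 4 := by positivity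
  have hk1 : min κ₁ κ₂ / 4 ≤ κ₁ / 4 := by
    have := min_le_left κ₁ κ₂
    linarith
  have hk2 : min κ₁ κ₂ / 4 ≤ κ₂ / 4 := by
    have := min_le_right κ₁ κ₂
    linarith
  -- δ = f x₀ / 4 combines the factor 1/2 of the free solution with f ≥ f x₀ / 2 on the strip.
  refine ⟨K, -x₀ - h / 2, -x₀ + h / 2, f x₀ / 4, min κ₁ κ₂ / 4, hK1, hlow, by linarith, hupp,
    by linarith, hk, fun ε T u hε hu => ?_⟩
  have hnn : ∀ ξ η, K ≤ ξ → -K ≤ η → ξ + η < 2 * T → 0 ≤ nullCoord u ξ η := by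
    intro ξ η h1 h2 h3
    refine le_trans ?_ (free_le_nullCoord hu hf (by linarith) h3)
    have := hf_nonneg ξ
    have := hf_nonneg (-η)
    positivity
  refine ⟨?_, ?_, ?_, ?_⟩
  · intro ξ η h1 h2 h3 h4
    refine le_trans ?_ (free_le_nullCoord hu hf (by linarith) h4)
    rw [hfK ξ h1]
    have := hstrip η h2 h3
    nlinarith
  · exact fun ξ η h1 h2 h3 => hnn ξ η h1 (by linarith) h3
  · intro ξ₀ ξ₁ η₀ η₁ ξ η μ h1 h2 h3 h4 h5 h6 h7 h8 hμ hw
    have := nullCoord_gain hu hf (ξ₀ := ξ₀) (ξ₁ := ξ₁) (η₀ := η₀) (η₁ := η₁) (ξ := ξ) (η := η)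
      (c := min κ₁ κ₂ / 4 * μ ^ p) (Φ := rpowPrimitive a) (Ψ := fun s => s) (H := fun _ => 1)
      (by linarith) h2 h3 h5 h7 h8
      (fun s hs => hasDerivAt_rpowPrimitive a (by linarith [hs.1])) (fun s _ => hasDerivAt_id s)
      fun x hx y hy => ?_
    · rw [hfK ξ (by linarith), hfK ξ₀ h1] at this
      have := hnn ξ₀ η h1 (by linarith) (by linarith)
      linarith
    · have e1 := hW₂ x y (abs_le.2 ⟨by linarith [hy.1], by linarith [hy.2]⟩) (by linarith [hx.1])
      have e2 : μ ^ p ≤ |nullCoord u x y| ^ p :=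
        Real.rpow_le_rpow hμ.le ((hw x hx y hy).trans (le_abs_self _)) (by linarith)
      have e3 : 0 ≤ x ^ (-(1 + a)) := Real.rpow_nonneg (by linarith [hx.1]) _
      have e4 : 0 ≤ μ ^ p := by positivity
      have e6 : 0 ≤ nullWeight a b x y := charWeight_nonneg _ _ _ _
      calc _ = (min κ₁ κ₂ / 4 * x ^ (-(1 + a))) * μ ^ p := by ring
        _ ≤ (κ₂ / 4 * x ^ (-(1 + a))) * μ ^ p := by gcongr
        _ = 1 / 4 * ((κ₂ * x ^ (-(1 + a))) * μ ^ p) := by ring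
        _ ≤ _ := by gcongr
  · intro ξ₀ ξ₁ η₀ η₁ ξ η μ h1 h2 h3 h4 h5 h6 h7 hμ hw
    have := nullCoord_gain hu hf (ξ₀ := ξ₀) (ξ₁ := ξ₁) (η₀ := η₀) (η₁ := η₁) (ξ := ξ) (η := η)
      (c := min κ₁ κ₂ / 4 * μ ^ p) (Φ := rpowPrimitive a) (Ψ := rpowPrimitive b)
      (by linarith) h4 h5 h2 h6 h7
      (fun s hs => hasDerivAt_rpowPrimitive a (by linarith [hs.1]))
      (fun s hs => hasDerivAt_rpowPrimitive b (by linarith [hs.1]))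
      fun x hx y hy => ?_
    · rw [hfK ξ (by linarith), hfK ξ₀ (by linarith)] at this
      linarith
    · have e1 := hW₁ x y (by linarith [hy.1]) (by linarith [hx.1, hy.2])
      have e2 : μ ^ p ≤ |nullCoord u x y| ^ p :=
        Real.rpow_le_rpow hμ.le ((hw x hx y hy).trans (le_abs_self _)) (by linarith)
      have e3 : 0 ≤ x ^ (-(1 + a)) := Real.rpow_nonneg (by linarith [hx.1]) _
      have e5 : 0 ≤ y ^ (-(1 + b)) := Real.rpow_nonneg (by linarith [hy.1]) _
      have e4 : 0 ≤ μ ^ p := by positivity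
      have e6 : 0 ≤ nullWeight a b x y := charWeight_nonneg _ _ _ _
      calc _ = (min κ₁ κ₂ / 4 * x ^ (-(1 + a)) * y ^ (-(1 + b))) * μ ^ p := by ring
        _ ≤ (κ₁ / 4 * x ^ (-(1 + a)) * y ^ (-(1 + b))) * μ ^ p := by gcongr
        _ = 1 / 4 * ((κ₁ * x ^ (-(1 + a)) * y ^ (-(1 + b))) * μ ^ p) := by ring
        _ ≤ _ := by gcongr

/-! ### Blow-up in the strip and in the interior -/

namespace NullGain

variable {p a b K ηm ηp δ k ε T : ℝ} {w : ℝ → ℝ → ℝ}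

lemma strip_bound (h : NullGain p a b K ηm ηp δ k ε T w) (hp : 1 < p) (hK : 1 ≤ K)
    (hη : ηm < ηp) (hδ : 0 < δ) (hk : 0 < k) (hε : 0 < ε) {N : ℝ} (hN : K ≤ N)
    (hNT : N + ηp < 2 * T) :
    k * (δ * ε) ^ (p - 1) * (rpowPrimitive a N - rpowPrimitive a K) * (ηp - ηm) <
      4 * 4 ^ (1 / (p - 1)) := by
  refine rectangle_bound (w := w) (Ψ := fun s => s) hp hk (mul_pos hδ hε) hN hη.le
    (fun s hs => (hasDerivAt_rpowPrimitive a (by linarith [hs.1])).continuousAt.continuousWithinAt)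
    continuousOn_id
    ((monotoneOn_rpowPrimitive a).mono fun s hs => show 0 < s by linarith [hs.1])
    monotoneOn_id
    (fun x hx y hy => h.strip x y hx.1 hy.1 hy.2 (by linarith [hx.2, hy.2])) ?_
  intro x hx x' hx' y hy y' hy' hxx hyy μ hμ hw s hs r hr
  exact h.strip_gain x x' y y' s r μ hx.1 hxx hs.1 hy.1 hyy hy'.2 hr.1
    (by linarith [hs.2, hr.2]) hμ
    fun s hs r hr => hw s ⟨hs.1, hs.2.trans hx'.2⟩ r ⟨hr.1, hr.2.trans hy'.2⟩

/-- The source generated in the strip by w ≥ δε up to ξ₀ reaches every later point; this is the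
origin of the power ε^p. -/
lemma interior_lower (h : NullGain p a b K ηm ηp δ k ε T w) (hδ : 0 < δ) (hε : 0 < ε)
    (hη : ηm < ηp) (hηK : ηp ≤ K) {ξ₀ ξ η : ℝ} (hξ₀ : K ≤ ξ₀) (hξ : ξ₀ ≤ ξ) (hηη : K ≤ η)
    (hT : ξ + η < 2 * T) :
    k * (δ * ε) ^ p * (rpowPrimitive a ξ₀ - rpowPrimitive a K) * (ηp - ηm) ≤ w ξ η :=
  h.strip_gain K ξ₀ ηm ηp ξ η (δ * ε) le_rfl hξ₀ hξ le_rfl hη.le le_rfl (by linarith) hT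
    (mul_pos hδ hε) fun x hx y hy => h.strip x y hx.1 hy.1 hy.2 (by linarith [hx.2, hy.2])

lemma rectangle (h : NullGain p a b K ηm ηp δ k ε T w) (hp : 1 < p) (hK : 1 ≤ K)
    (hk : 0 < k) {ξ₀ ξ₁ η₀ η₁ m : ℝ} (hm : 0 < m) (h0 : K ≤ η₀) (h1 : η₀ ≤ η₁) (h2 : η₁ ≤ ξ₀)
    (h3 : ξ₀ ≤ ξ₁) (hT : ξ₁ + η₁ < 2 * T)
    (hw : ∀ x ∈ Icc ξ₀ ξ₁, ∀ y ∈ Icc η₀ η₁, m ≤ w x y) :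
    k * m ^ (p - 1) * (rpowPrimitive a ξ₁ - rpowPrimitive a ξ₀) *
      (rpowPrimitive b η₁ - rpowPrimitive b η₀) < 4 * 4 ^ (1 / (p - 1)) := by
  refine rectangle_bound (w := w) hp hk hm h3 h1
    (fun s hs => (hasDerivAt_rpowPrimitive a (by linarith [hs.1])).continuousAt.continuousWithinAt)
    (fun s hs => (hasDerivAt_rpowPrimitive b (by linarith [hs.1])).continuousAt.continuousWithinAt)
    ((monotoneOn_rpowPrimitive a).mono fun s hs => show 0 < s by linarith [hs.1])
    ((monotoneOn_rpowPrimitive b).mono fun s hs => show 0 < s by linarith [hs.1]) hw ?_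
  intro x hx x' hx' y hy y' hy' hxx hyy μ hμ hw s hs r hr
  have e := h.gain x x' y y' s r μ (by linarith [hy.1]) hyy (by linarith [hy'.2, hx.1]) hxx hs.1
    hr.1 (by linarith [hs.2, hr.2]) hμ
    fun s hs r hr => hw s ⟨hs.1, hs.2.trans hx'.2⟩ r ⟨hr.1, hr.2.trans hy'.2⟩
  have := h.nonneg x r (by linarith [hx.1]) (by linarith [hr.1, hy'.1]) (by linarith [hx.2, hr.2])
  linarith

end NullGain

/-- Consequence of the blow-up in the strip, uniform in `ε` and `T`. -/
lemma exists_strip_bound {p a b K ηm ηp δ k : ℝ} (hp : 1 < p) (hK : 1 ≤ K) (hη : ηm < ηp)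
    (hηK : ηp ≤ K) (hδ : 0 < δ) (hk : 0 < k) :
    ∃ C : ℝ, 0 < C ∧ ∀ ε T w, 0 < ε → NullGain p a b K ηm ηp δ k ε T w → K < T →
      rpowPrimitive a T - rpowPrimitive a K < C * ε ^ (-(p - 1)) := by
  have hL : 0 < ηp - ηm := by linarith
  refine ⟨4 * 4 ^ (1 / (p - 1)) / (k * δ ^ (p - 1) * (ηp - ηm)), by positivity, ?_⟩
  intro ε T w hε h hT
  have := h.strip_bound hp hK hη hδ hk hε hT.le (by linarith)
  rw [Real.rpow_neg hε.le, ← div_eq_mul_inv, div_div, lt_div_iff₀ (by positivity)]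
  rw [Real.mul_rpow hδ.le hε.le] at this
  linarith

/-- Consequence of the blow-up in the region `K ≤ η ≤ ξ`, uniform in `ε` and `T`. -/
lemma exists_interior_bound {p a b K ηm ηp δ k : ℝ} (hp : 1 < p) (hK : 1 ≤ K) (hη : ηm < ηp)
    (hηK : ηp ≤ K) (hδ : 0 < δ) (hk : 0 < k) :
    ∃ C : ℝ, 0 < C ∧ ∀ ε T w, 0 < ε → NullGain p a b K ηm ηp δ k ε T w →
      ∀ ξ₀ ξ₁ A B D, K ≤ ξ₀ → ξ₀ ≤ ξ₁ → ξ₁ + ξ₀ < 2 * T → 0 < A → 0 < B → 0 < D →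
      A ≤ rpowPrimitive a ξ₀ - rpowPrimitive a K → B ≤ rpowPrimitive a ξ₁ - rpowPrimitive a ξ₀ →
      D ≤ rpowPrimitive b ξ₀ - rpowPrimitive b K →
      A ^ (p - 1) * B * D < C * ε ^ (-(p * (p - 1))) := by
  have hL : 0 < ηp - ηm := by linarith
  refine ⟨4 * 4 ^ (1 / (p - 1)) / (k * (k * δ ^ p * (ηp - ηm)) ^ (p - 1)), by positivity, ?_⟩
  intro ε T w hε h ξ₀ ξ₁ A B D h0 h1 hT hA hB hD hA' hB' hD'
  have hb := h.rectangle hp hK hk (ξ₀ := ξ₀) (ξ₁ := ξ₁) (η₀ := K) (η₁ := ξ₀)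
    (m := k * (δ * ε) ^ p * A * (ηp - ηm)) (by positivity) le_rfl h0 le_rfl h1 hT
    fun x hx y hy => by
      refine le_trans ?_ (h.interior_lower hδ hε hη hηK h0 hx.1 hy.1 (by linarith [hx.2, hy.2]))
      gcongr
  rw [Real.rpow_neg hε.le, ← div_eq_mul_inv, div_div, lt_div_iff₀ (by positivity)]
  refine lt_of_le_of_lt ?_ hb
  have e : (k * (δ * ε) ^ p * A * (ηp - ηm)) ^ (p - 1) =
      (k * δ ^ p * (ηp - ηm)) ^ (p - 1) * ε ^ (p * (p - 1)) * A ^ (p - 1) := by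
    rw [Real.rpow_mul hε.le, ← Real.mul_rpow (by positivity) (by positivity),
      ← Real.mul_rpow (by positivity) hA.le, Real.mul_rpow hδ.le hε.le]
    congr 1
    ring
  have hB0 : 0 ≤ rpowPrimitive a ξ₁ - rpowPrimitive a ξ₀ := by linarith
  rw [e]
  calc _ = k * ((k * δ ^ p * (ηp - ηm)) ^ (p - 1) * ε ^ (p * (p - 1)) * A ^ (p - 1)) * B * D := by
        ring
    _ ≤ _ := by gcongr

/-! ### The scale-invariant case -/

/-- For `q > 0` the function `(1 + s) ^ (-q)` decays at a linear rate on `[0, S]`. -/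
lemma exists_one_add_rpow_neg_le {q S : ℝ} (hq : 0 < q) (hS : 0 ≤ S) :
    ∃ θ : ℝ, 0 < θ ∧ ∀ s, 0 ≤ s → s ≤ S → (1 + s) ^ (-q) ≤ 1 - θ * s := by
  set c := q / (1 + S) with hc
  have hc0 : 0 < c := by positivity
  refine ⟨c / (1 + c * S), by positivity, fun s hs hsS => ?_⟩
  have h1 : 1 + c * s ≤ (1 + s) ^ q := by
    have h2 : 1 - (1 + s)⁻¹ ≤ Real.log (1 + s) := Real.one_sub_inv_le_log_of_pos (by linarith)
    have h3 : s / (1 + S) ≤ 1 - (1 + s)⁻¹ := by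
      have : 1 - (1 + s)⁻¹ = s / (1 + s) := by
        field_simp
        ring
      rw [this]
      gcongr
    have h4 : c * s ≤ Real.log (1 + s) * q := by
      have : c * s = s / (1 + S) * q := by
        rw [hc]
        ring
      rw [this]
      gcongr
      linarith
    rw [Real.rpow_def_of_pos (by linarith)]
    linarith [Real.add_one_le_exp (Real.log (1 + s) * q)]
  rw [Real.rpow_neg (by linarith)]
  refine (inv_anti₀ (by positivity) h1).trans ?_
  rw [inv_le_iff_one_le_mul₀ (by positivity)]
  have h5 : c / (1 + c * S) * s * (1 + c * s) ≤ c * s := by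
    rw [div_mul_eq_mul_div, div_mul_eq_mul_div, div_le_iff₀ (by positivity)]
    gcongr
  nlinarith

/-- A discrete form of y' = c y^(q+1), for which y^(-q) decreases linearly. The cap S is needed
because (1 + s)^(-q) lies below a decreasing line only on bounded intervals. -/
lemma exists_rpow_neg_iterate_le {q c S : ℝ} (hq : 0 < q) (hc : 0 < c) (hS : 0 ≤ S) :
    ∃ θ : ℝ, 0 < θ ∧ ∀ μ, 0 < μ → c * μ ^ q ≤ S →
      (μ + c * μ ^ (q + 1)) ^ (-q) ≤ μ ^ (-q) - θ := by
  obtain ⟨θ, hθ, h⟩ := exists_one_add_rpow_neg_le hq hS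
  refine ⟨θ * c, by positivity, fun μ hμ hμS => ?_⟩
  have e : μ + c * μ ^ (q + 1) = μ * (1 + c * μ ^ q) := by
    rw [Real.rpow_add_one hμ.ne']
    ring
  have h1 := h (c * μ ^ q) (by positivity) hμS
  rw [e, Real.mul_rpow hμ.le (by positivity)]
  calc μ ^ (-q) * (1 + c * μ ^ q) ^ (-q) ≤ μ ^ (-q) * (1 - θ * (c * μ ^ q)) := by gcongr
    _ = μ ^ (-q) - θ * c * (μ ^ (-q) * μ ^ q) := by ring
    _ = μ ^ (-q) - θ * c := by
      rw [← Real.rpow_add hμ, neg_add_cancel, Real.rpow_zero, mul_one]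

/-- Blow-up in the scale-invariant case `a + b = 0`: each dyadic scale raises a lower bound `μ` by
a multiple of `μ ^ p`. -/
lemma exists_scale_invariant_bound {p a b K ηm ηp δ k : ℝ} (hp : 1 < p) (hK : 1 ≤ K)
    (hη : ηm < ηp) (hηK : ηp ≤ K) (hδ : 0 < δ) (hk : 0 < k) (hab : a + b = 0) :
    ∃ C : ℝ, 0 < C ∧ ∀ ε T w, 0 < ε → NullGain p a b K ηm ηp δ k ε T w →
      ∀ J : ℕ, 4 ^ J * (6 * K) < T → (J : ℝ) ≤ C * ε ^ (-(p * (p - 1))) := by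
  have hL : 0 < ηp - ηm := by linarith
  obtain ⟨da, hda, hDa⟩ := exists_rpowPrimitive_doubling a
  obtain ⟨db, hdb, hDb⟩ := exists_rpowPrimitive_doubling b
  have hq : 0 < p - 1 := by linarith
  -- The gain over [2N, 4N] × [N, 2N] does not depend on N, because N^(-a) N^(-b) = 1.
  have hprod : ∀ N : ℝ, 0 < N → (rpowPrimitive a (2 * (2 * N)) - rpowPrimitive a (2 * N)) *
      (rpowPrimitive b (2 * N) - rpowPrimitive b N) = da * db * 2 ^ (-a) := by
    intro N hN
    rw [hDa _ (by positivity), hDb _ hN, Real.mul_rpow (by norm_num) hN.le]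
    have : N ^ (-a) * N ^ (-b) = 1 := by
      rw [← Real.rpow_add hN, show -a + -b = 0 by linarith, Real.rpow_zero]
    calc _ = da * db * 2 ^ (-a) * (N ^ (-a) * N ^ (-b)) := by ring
      _ = _ := by rw [this, mul_one]
  set c₁ := k * (da * db * 2 ^ (-a)) with hc₁
  have hc₁0 : 0 < c₁ := by positivity
  obtain ⟨θ, hθ, hiter⟩ := exists_rpow_neg_iterate_le (S := 4 * 4 ^ (1 / (p - 1))) hq hc₁0
    (by positivity)
  set c₀ := k * δ ^ p * (da * K ^ (-a)) * (ηp - ηm) with hc₀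
  have hc₀0 : 0 < c₀ := by positivity
  refine ⟨c₀ ^ (-(p - 1)) / θ, by positivity, ?_⟩
  intro ε T w hε h J hJ
  have key : ∀ j : ℕ, j ≤ J → ∃ μ, 0 < μ ∧ μ ^ (-(p - 1)) ≤ (c₀ * ε ^ p) ^ (-(p - 1)) - j * θ ∧
      ∀ ξ η, 4 ^ j * (2 * K) ≤ ξ → 4 ^ j * (2 * K) ≤ η → ξ + η < 2 * T → μ ≤ w ξ η := by
    intro j
    induction j with
    | zero =>
      intro _
      refine ⟨c₀ * ε ^ p, by positivity, by simp, fun ξ η hξ hη' hT => ?_⟩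
      rw [pow_zero, one_mul] at hξ hη'
      have e := h.interior_lower hδ hε hη hηK (ξ₀ := 2 * K) (ξ := ξ) (η := η) (by linarith) hξ
        (by linarith) hT
      rw [hDa K (by linarith), Real.mul_rpow hδ.le hε.le] at e
      refine le_trans (le_of_eq ?_) e
      rw [hc₀]
      ring
    | succ j ih =>
      intro hj
      obtain ⟨μ, hμ, hμz, hw⟩ := ih (by omega)
      set N : ℝ := 4 ^ j * (2 * K) with hN
      have h4 : (1 : ℝ) ≤ 4 ^ j := one_le_pow₀ (by norm_num)
      have hNK : K ≤ N := by nlinarith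
      have h4J : (4 : ℝ) ^ (j + 1) ≤ 4 ^ J := pow_le_pow_right₀ (by norm_num) hj
      have hNT : 12 * N < T := by
        refine lt_of_le_of_lt ?_ hJ
        rw [pow_succ] at h4J
        rw [hN]
        nlinarith
      -- `rectangle_bound` on the same rectangle keeps μ below the cap required by the iteration.
      have hsmall : c₁ * μ ^ (p - 1) ≤ 4 * 4 ^ (1 / (p - 1)) := by
        have e := h.rectangle hp hK hk (ξ₀ := 2 * N) (ξ₁ := 2 * (2 * N)) (η₀ := N) (η₁ := 2 * N) hμ
          hNK (by linarith) le_rfl (by linarith) (by linarith)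
          fun x hx y hy => hw x y (by linarith [hx.1]) hy.1 (by linarith [hx.2, hy.2])
        refine le_trans (le_of_eq ?_) e.le
        rw [hc₁, ← hprod N (by linarith)]
        ring
      refine ⟨μ + c₁ * μ ^ (p - 1 + 1), by positivity, ?_, fun ξ η hξ hη' hT => ?_⟩
      · have := hiter μ hμ hsmall
        push_cast
        linarith
      · have hN4 : 4 ^ (j + 1) * (2 * K) = 4 * N := by
          rw [hN]
          ring
        rw [hN4] at hξ hη'
        have e := h.gain (2 * N) (2 * (2 * N)) N (2 * N) ξ η μ hNK (by linarith) le_rfl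
          (by linarith) (by linarith) (by linarith) hT hμ
          fun x hx y hy => hw x y (by linarith [hx.1]) hy.1 (by linarith [hx.2, hy.2])
        have e2 := hw (2 * N) η (by linarith) (by linarith) (by linarith)
        rw [mul_assoc, hprod N (by linarith)] at e
        rw [sub_add_cancel, hc₁]
        linarith
  -- Positivity of μ^(-(p-1)) forces Jθ below its initial value, of order ε^(-p(p-1)).
  obtain ⟨μ, hμ, hz, -⟩ := key J le_rfl
  have h0 : 0 < μ ^ (-(p - 1)) := by positivity
  rw [Real.mul_rpow hc₀0.le (by positivity), ← Real.rpow_mul hε.le, mul_neg] at hz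
  rw [div_mul_eq_mul_div, le_div_iff₀ hθ]
  linarith

/-! ### From thresholds on T to lower bounds -/

lemma one_le_rpow_neg {ε Q : ℝ} (hε : 0 < ε) (hε1 : ε ≤ 1) (hQ : 0 ≤ Q) : 1 ≤ ε ^ (-Q) :=
  Real.one_le_rpow_of_pos_of_le_one_of_nonpos hε hε1 (by linarith)

lemma exists_rpow_threshold {r C : ℝ} (M : ℝ) (hr : 0 < r) (hC : 0 < C) :
    ∃ C' : ℝ, 0 < C' ∧ ∀ ε, 0 < ε → ε ≤ 1 → ∀ Q : ℝ, 0 ≤ Q → ∀ T, C' * ε ^ (-(Q / r)) ≤ T →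
      M ≤ T ∧ C * ε ^ (-Q) ≤ T ^ r := by
  refine ⟨max 1 (max M (C ^ (1 / r))), by positivity, fun ε hε hε1 Q hQ T hT => ?_⟩
  set C' := max 1 (max M (C ^ (1 / r))) with hC'
  have h0 : 1 ≤ C' := le_max_left _ _
  have h1 : M ≤ C' := (le_max_left _ _).trans (le_max_right _ _)
  have h2 : C ^ (1 / r) ≤ C' := (le_max_right _ _).trans (le_max_right _ _)
  have hE := one_le_rpow_neg hε hε1 (div_nonneg hQ hr.le)
  refine ⟨by nlinarith, ?_⟩
  calc C * ε ^ (-Q) = (C ^ (1 / r) * ε ^ (-(Q / r))) ^ r := by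
        rw [Real.mul_rpow (by positivity) (by positivity), ← Real.rpow_mul hC.le,
          ← Real.rpow_mul hε.le, one_div_mul_cancel hr.ne', Real.rpow_one, neg_mul,
          div_mul_cancel₀ _ hr.ne']
    _ ≤ (C' * ε ^ (-(Q / r))) ^ r := by gcongr
    _ ≤ T ^ r := by gcongr

lemma le_log_of_exp_le {ε Q C M T : ℝ} (hε : 0 < ε) (hε1 : ε ≤ 1) (hQ : 0 ≤ Q) (hC : 0 ≤ C)
    (hM : 0 < M) (hCM : Real.log M ≤ C) (h : Real.exp (C * ε ^ (-Q)) ≤ T) :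
    M ≤ T ∧ C * ε ^ (-Q) ≤ Real.log T := by
  have hT : 0 < T := (Real.exp_pos _).trans_le h
  have hl := (Real.le_log_iff_exp_le hT).2 h
  have hE := one_le_rpow_neg hε hε1 hQ
  exact ⟨(Real.log_le_log_iff hM hT).1 (by nlinarith), hl⟩

lemma monotoneOn_rpow_mul_log {c d : ℝ} (hc : 0 ≤ c) (hd : 0 ≤ d) :
    MonotoneOn (fun s : ℝ => s ^ c * Real.log (2 + s) ^ d) (Ici 0) := by
  intro x hx y hy hxy
  have hx : (0 : ℝ) ≤ x := hx
  have hl : 0 ≤ Real.log (2 + x) := Real.log_nonneg (by linarith)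
  have hll : Real.log (2 + x) ≤ Real.log (2 + y) :=
    Real.log_le_log (by linarith) (by linarith)
  have hy : (0 : ℝ) ≤ y := hy
  simp only
  gcongr

lemma monotoneOn_psi1 {p a : ℝ} (hp : 1 < p) (ha : a < 0) : MonotoneOn (psi1 p a) (Ici 0) := by
  have h := monotoneOn_rpow_mul_log (c := -(p * a)) (d := 1) (by nlinarith) zero_le_one
  simp only [Real.rpow_one] at h
  exact h

lemma monotoneOn_psi2 {p b : ℝ} (hp : 1 < p) (hb : b < 0) : MonotoneOn (psi2 p b) (Ici 0) :=
  monotoneOn_rpow_mul_log (by linarith) (by linarith)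

lemma le_of_invFunOn_le {ψ : ℝ → ℝ} (hb : BijOn ψ (Ici 0) (Ici 0)) (hm : MonotoneOn ψ (Ici 0))
    {y T : ℝ} (hy : 0 ≤ y) (h : Function.invFunOn ψ (Ici 0) y ≤ T) : 0 ≤ T ∧ y ≤ ψ T := by
  have hex : ∃ s ∈ Ici (0 : ℝ), ψ s = y := hb.surjOn hy
  have h0 : 0 ≤ Function.invFunOn ψ (Ici 0) y := Function.invFunOn_mem hex
  refine ⟨h0.trans h, ?_⟩
  calc y = ψ (Function.invFunOn ψ (Ici 0) y) := (Function.invFunOn_eq hex).symm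
    _ ≤ ψ T := hm h0 (h0.trans h) h

/-- As ε^(-Q) ≥ 1, adding ψ M to the constant forces T ≥ M by monotonicity. -/
lemma exists_invFunOn_threshold {ψ : ℝ → ℝ} (hb : BijOn ψ (Ici 0) (Ici 0))
    (hm : MonotoneOn ψ (Ici 0)) {C M : ℝ} (hC : 0 < C) (hM : 0 ≤ M) :
    ∃ C' : ℝ, 0 < C' ∧ ∀ ε, 0 < ε → ε ≤ 1 → ∀ Q : ℝ, 0 ≤ Q → ∀ T,
      Function.invFunOn ψ (Ici 0) (C' * ε ^ (-Q)) ≤ T → M ≤ T ∧ C * ε ^ (-Q) ≤ ψ T := by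
  have h0 : 0 ≤ ψ M := hb.mapsTo hM
  refine ⟨C + ψ M, by positivity, fun ε hε hε1 Q hQ T hT => ?_⟩
  have hE := one_le_rpow_neg hε hε1 hQ
  obtain ⟨hT0, h⟩ := le_of_invFunOn_le hb hm (by positivity) hT
  refine ⟨?_, by nlinarith⟩
  by_contra! hlt
  have := hm hT0 hM hlt.le
  nlinarith

/-! ### Lifespan estimates case by case -/

/-- The bound of `exists_interior_bound` for a family of solvable pairs `(ε, T)`. -/
def InteriorBound (p a b K C : ℝ) (Sol : ℝ → ℝ → Prop) : Prop :=
  ∀ ε T, 0 < ε → Sol ε T → ∀ ξ₀ ξ₁ A B D, K ≤ ξ₀ → ξ₀ ≤ ξ₁ → ξ₁ + ξ₀ < 2 * T →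
    0 < A → 0 < B → 0 < D → A ≤ rpowPrimitive a ξ₀ - rpowPrimitive a K →
    B ≤ rpowPrimitive a ξ₁ - rpowPrimitive a ξ₀ → D ≤ rpowPrimitive b ξ₀ - rpowPrimitive b K →
    A ^ (p - 1) * B * D < C * ε ^ (-(p * (p - 1)))

section lifespan

variable {p a b K C : ℝ} {Sol : ℝ → ℝ → Prop}

lemma lifespan_strip_exp (hp : 1 < p) (hK : 1 ≤ K) (hC : 0 < C)
    (h : ∀ ε T, 0 < ε → Sol ε T → K < T →
      rpowPrimitive 0 T - rpowPrimitive 0 K < C * ε ^ (-(p - 1))) :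
    ∃ C' : ℝ, 0 < C' ∧ ∀ ε, 0 < ε → ε ≤ 1 → ∀ T, Real.exp (C' * ε ^ (-(p - 1))) ≤ T →
      ¬ Sol ε T := by
  have hlog : 0 ≤ Real.log (K + 1) := Real.log_nonneg (by linarith)
  refine ⟨C + Real.log (K + 1), by positivity, fun ε hε hε1 T hT hS => ?_⟩
  have hE := one_le_rpow_neg hε hε1 (show 0 ≤ p - 1 by linarith)
  obtain ⟨h1, h2⟩ := le_log_of_exp_le hε hε1 (by linarith) (by positivity) (M := K + 1)
    (by linarith) (by linarith) hT
  have h3 := h ε T hε hS (by linarith)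
  rw [rpowPrimitive_zero_sub (by linarith) (by linarith),
    Real.log_div (by linarith) (by linarith)] at h3
  have h4 : Real.log K ≤ Real.log (K + 1) := Real.log_le_log (by linarith) (by linarith)
  nlinarith

lemma lifespan_strip_rpow (hp : 1 < p) (hK : 1 ≤ K) (hC : 0 < C) (ha : a < 0)
    (h : ∀ ε T, 0 < ε → Sol ε T → K < T →
      rpowPrimitive a T - rpowPrimitive a K < C * ε ^ (-(p - 1))) :
    ∃ C' : ℝ, 0 < C' ∧ ∀ ε, 0 < ε → ε ≤ 1 → ∀ T, C' * ε ^ (-((p - 1) / (-a))) ≤ T →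
      ¬ Sol ε T := by
  obtain ⟨d, hd, hD⟩ := exists_rpowPrimitive_half a
  obtain ⟨C', hC', h'⟩ := exists_rpow_threshold (2 * K) (show 0 < -a by linarith)
    (show 0 < C / d by positivity)
  refine ⟨C', hC', fun ε hε hε1 T hT hS => ?_⟩
  obtain ⟨h1, h2⟩ := h' ε hε hε1 (p - 1) (by linarith) T hT
  have h3 := h ε T hε hS (by linarith)
  have h4 := hD T (by linarith)
  have h5 := rpowPrimitive_mono a (show 0 < K by linarith) (show K ≤ T / 2 by linarith)
  rw [div_mul_eq_mul_div, div_le_iff₀ hd] at h2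
  linarith

lemma lifespan_interior_exp (hp : 1 < p) (hK : 1 ≤ K) (hC : 0 < C)
    (h : InteriorBound p 0 0 K C Sol) :
    ∃ C' : ℝ, 0 < C' ∧ ∀ ε, 0 < ε → ε ≤ 1 → ∀ T,
      Real.exp (C' * ε ^ (-(p * (p - 1) / (p + 1)))) ≤ T → ¬ Sol ε T := by
  have hlog : 0 ≤ Real.log K := Real.log_nonneg hK
  -- The factor 4 pays for using log T / 4 below; the summand log K ensures K ≤ √T and absorbs log K
  -- in the increments.
  refine ⟨4 * (C + 1 + Real.log K), by positivity, fun ε hε hε1 T hT hS => ?_⟩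
  have hp0 : 0 < p - 1 := by linarith
  have hQ : 0 ≤ p * (p - 1) / (p + 1) := by positivity
  have hE := one_le_rpow_neg hε hε1 hQ
  set E := ε ^ (-(p * (p - 1) / (p + 1))) with hEdef
  obtain ⟨h1, h2⟩ := le_log_of_exp_le hε hε1 hQ (by positivity) (M := 1)
    (by linarith) (by rw [Real.log_one]; positivity) hT
  rw [← hEdef] at h2
  have h3 : C + 1 + Real.log K ≤ Real.log T / 4 := by nlinarith
  have h4 : (C + 1) * E ≤ Real.log T / 4 := by nlinarith
  have hT1 : 1 < T := h1.lt_of_ne fun e => by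
    rw [← e, Real.log_one] at h3
    linarith
  have hs : 0 < Real.sqrt T := Real.sqrt_pos.2 (by linarith)
  have hsT : Real.sqrt T < T := by
    rw [Real.sqrt_lt' (by linarith)]
    nlinarith
  have hKs : K ≤ Real.sqrt T := by
    rw [← Real.log_le_log_iff (by linarith) hs, Real.log_sqrt (by linarith)]
    linarith
  have hA : 0 < Real.log T / 4 := by linarith
  -- With ξ₀ = √T and ξ₁ = T all three increments are at least log T / 4, giving the power p + 1; ξ₀
  -- = T/2 would leave only a constant for B.
  have hb := h ε T hε hS (Real.sqrt T) T (Real.log T / 4) (Real.log T / 4) (Real.log T / 4) hKs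
    hsT.le (by linarith) hA hA hA
    (by
      rw [rpowPrimitive_zero_sub (by linarith) hs, Real.log_div hs.ne' (by linarith),
        Real.log_sqrt (by linarith)]
      linarith)
    (by
      rw [rpowPrimitive_zero_sub hs (by linarith), Real.log_div (by linarith) hs.ne',
        Real.log_sqrt (by linarith)]
      linarith)
    (by
      rw [rpowPrimitive_zero_sub (by linarith) hs, Real.log_div hs.ne' (by linarith),
        Real.log_sqrt (by linarith)]
      linarith)
  have e1 : (Real.log T / 4) ^ (p - 1) * (Real.log T / 4) * (Real.log T / 4) =
      (Real.log T / 4) ^ (p + 1) := by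
    rw [Real.rpow_sub_one hA.ne', Real.rpow_add_one hA.ne', div_mul_cancel₀ _ hA.ne']
  have e2 : E ^ (p + 1) = ε ^ (-(p * (p - 1))) := by
    rw [hEdef, ← Real.rpow_mul hε.le, neg_mul, div_mul_cancel₀ _ (by linarith)]
  have e3 : C ≤ (C + 1) ^ (p + 1) :=
    (by linarith : C ≤ C + 1).trans (Real.self_le_rpow_of_one_le (by linarith) (by linarith))
  have e4 : C * E ^ (p + 1) ≤ (Real.log T / 4) ^ (p + 1) := by
    calc C * E ^ (p + 1) ≤ (C + 1) ^ (p + 1) * E ^ (p + 1) := by gcongr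
      _ = ((C + 1) * E) ^ (p + 1) := (Real.mul_rpow (by linarith) (by linarith)).symm
      _ ≤ _ := Real.rpow_le_rpow (by positivity) h4 (by linarith)
  rw [e1, ← e2] at hb
  linarith

lemma lifespan_scale_invariant (hp : 1 < p) (hK : 1 ≤ K) (hC : 0 < C)
    (h : ∀ ε T, 0 < ε → Sol ε T → ∀ J : ℕ, 4 ^ J * (6 * K) < T →
      (J : ℝ) ≤ C * ε ^ (-(p * (p - 1)))) :
    ∃ C' : ℝ, 0 < C' ∧ ∀ ε, 0 < ε → ε ≤ 1 → ∀ T, Real.exp (C' * ε ^ (-(p * (p - 1)))) ≤ T →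
      ¬ Sol ε T := by
  have hlog : 0 ≤ Real.log (6 * K) := Real.log_nonneg (by linarith)
  have hlog4 : 0 < Real.log 4 := Real.log_pos (by norm_num)
  refine ⟨Real.log 4 * (C + 1) + Real.log (6 * K) + 1, by positivity, fun ε hε hε1 T hT hS => ?_⟩
  have hE := one_le_rpow_neg hε hε1 (show 0 ≤ p * (p - 1) by nlinarith)
  set E := ε ^ (-(p * (p - 1))) with hEdef
  have h1 := Nat.lt_floor_add_one (C * E)
  have h2 := Nat.floor_le (show 0 ≤ C * E by positivity)
  -- One scale more than the bound C E allows; C' is chosen so that these scales still fit below T.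
  refine absurd (h ε T hε hS (⌊C * E⌋₊ + 1) (lt_of_lt_of_le ?_ hT)) (by push_cast; linarith)
  have e : (4 : ℝ) ^ (⌊C * E⌋₊ + 1) * (6 * K) =
      Real.exp (((⌊C * E⌋₊ + 1 : ℕ) : ℝ) * Real.log 4 + Real.log (6 * K)) := by
    rw [Real.exp_add, Real.exp_log (by linarith), Real.exp_nat_mul, Real.exp_log (by norm_num)]
  rw [e, Real.exp_lt_exp]
  push_cast
  nlinarith

/-- The choice ξ₀ = T/2, ξ₁ = T makes B an exact multiple of T^(-a). -/
lemma scale_bound_of_interior (hK : 1 ≤ K)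
    (h : InteriorBound p a b K C Sol) :
    ∃ d : ℝ, 0 < d ∧ ∀ ε T, 0 < ε → Sol ε T → 4 * K ≤ T → ∀ A D, 0 < A → 0 < D →
      A ≤ rpowPrimitive a (T / 2) - rpowPrimitive a K →
      D ≤ rpowPrimitive b (T / 2) - rpowPrimitive b K →
      A ^ (p - 1) * (d * T ^ (-a)) * D < C * ε ^ (-(p * (p - 1))) := by
  obtain ⟨d, hd, hD⟩ := exists_rpowPrimitive_half a
  refine ⟨d, hd, fun ε T hε hS hT A D hA hD0 hA' hD' => ?_⟩
  have hT0 : 0 < T := by linarith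
  exact h ε T hε hS (T / 2) T A (d * T ^ (-a)) D (by linarith) (by linarith) (by linarith) hA
    (by positivity) hD0 hA' (hD T hT0).ge hD'

lemma mul_rpow_neg_rpow_mul {d₁ d₂ T : ℝ} (hd₁ : 0 < d₁) (hT : 0 < T) :
    (d₁ * T ^ (-a)) ^ (p - 1) * (d₂ * T ^ (-a)) = d₁ ^ (p - 1) * d₂ * T ^ (-(p * a)) := by
  have e : T ^ (-(p * a)) = (T ^ (-a)) ^ (p - 1) * T ^ (-a) := by
    rw [← Real.rpow_mul hT.le, ← Real.rpow_add hT]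
    congr 1
    ring
  rw [e, Real.mul_rpow hd₁.le (by positivity)]
  ring

/-- A and B are of order T^(-a) and D is logarithmic, so A^(p-1) B D reproduces ψ₁. -/
lemma lifespan_psi1 (hp : 1 < p) (hK : 1 ≤ K) (hC : 0 < C)
    (h : InteriorBound p a b K C Sol) (ha : a < 0) (hb : b = 0) :
    ∃ C' : ℝ, 0 < C' ∧ ∀ ε, 0 < ε → ε ≤ 1 → ∀ T,
      psi1Inv p a (C' * ε ^ (-(p * (p - 1)))) ≤ T → ¬ Sol ε T := by
  subst hb
  obtain ⟨d₁, hd₁, hD₁⟩ := exists_le_rpowPrimitive_sub a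
  obtain ⟨d₂, hd₂, hB⟩ := scale_bound_of_interior hK h
  obtain ⟨C', hC', h'⟩ := exists_invFunOn_threshold (bijOn_psi1 hp ha) (monotoneOn_psi1 hp ha)
    (C := C / (d₁ ^ (p - 1) * d₂ / 2)) (M := 16 * K ^ 2) (by positivity) (by positivity)
  refine ⟨C', hC', fun ε hε hε1 T hT hS => ?_⟩
  obtain ⟨h1, h2⟩ := h' ε hε hε1 (p * (p - 1)) (by nlinarith) T hT
  have hKT : 4 * K ≤ T := by nlinarith
  have hT0 : 0 < T := by linarith
  have hl : 0 < Real.log (2 + T) := Real.log_pos (by linarith)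
  have h3 := hB ε T hε hS hKT _ _ (by positivity) (by positivity) (hD₁ K T (by linarith) hKT)
    (half_log_le_rpowPrimitive_sub hK h1)
  rw [mul_rpow_neg_rpow_mul hd₁ hT0] at h3
  rw [div_mul_eq_mul_div, div_le_iff₀ (by positivity), psi1] at h2
  linarith

/-- Now A is logarithmic, B constant and D of order T^(-b), which reproduces ψ₂. -/
lemma lifespan_psi2 (hp : 1 < p) (hK : 1 ≤ K) (hC : 0 < C)
    (h : InteriorBound p a b K C Sol) (ha : a = 0) (hb : b < 0) :
    ∃ C' : ℝ, 0 < C' ∧ ∀ ε, 0 < ε → ε ≤ 1 → ∀ T,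
      psi2Inv p b (C' * ε ^ (-(p * (p - 1)))) ≤ T → ¬ Sol ε T := by
  subst ha
  obtain ⟨d₁, hd₁, hD₁⟩ := exists_le_rpowPrimitive_sub b
  obtain ⟨d₂, hd₂, hB⟩ := scale_bound_of_interior hK h
  obtain ⟨C', hC', h'⟩ := exists_invFunOn_threshold (bijOn_psi2 hp hb) (monotoneOn_psi2 hp hb)
    (C := C / ((1 / 2) ^ (p - 1) * d₂ * d₁)) (M := 16 * K ^ 2) (by positivity) (by positivity)
  refine ⟨C', hC', fun ε hε hε1 T hT hS => ?_⟩
  obtain ⟨h1, h2⟩ := h' ε hε hε1 (p * (p - 1)) (by nlinarith) T hT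
  have hKT : 4 * K ≤ T := by nlinarith
  have hT0 : 0 < T := by linarith
  have hl : 0 < Real.log (2 + T) := Real.log_pos (by linarith)
  have h3 := hB ε T hε hS hKT _ _ (by positivity) (by positivity)
    (half_log_le_rpowPrimitive_sub hK h1) (hD₁ K T (by linarith) hKT)
  rw [Real.mul_rpow (by norm_num) hl.le, neg_zero, Real.rpow_zero] at h3
  rw [div_mul_eq_mul_div, div_le_iff₀ (by positivity), psi2] at h2
  linarith

lemma lifespan_interior_rpow (hp : 1 < p) (hK : 1 ≤ K) (hC : 0 < C)
    (h : InteriorBound p a b K C Sol) (hab : 0 < -(p * a) - b) :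
    ∃ C' : ℝ, 0 < C' ∧ ∀ ε, 0 < ε → ε ≤ 1 → ∀ T,
      C' * ε ^ (-(p * (p - 1) / (-(p * a) - b))) ≤ T → ¬ Sol ε T := by
  obtain ⟨d₁, hd₁, hD₁⟩ := exists_le_rpowPrimitive_sub a
  obtain ⟨d₂, hd₂, hB⟩ := scale_bound_of_interior hK h
  obtain ⟨d₃, hd₃, hD₃⟩ := exists_le_rpowPrimitive_sub b
  obtain ⟨C', hC', h'⟩ := exists_rpow_threshold (4 * K) hab
    (show 0 < C / (d₁ ^ (p - 1) * d₂ * d₃) by positivity)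
  refine ⟨C', hC', fun ε hε hε1 T hT hS => ?_⟩
  obtain ⟨hKT, h2⟩ := h' ε hε hε1 (p * (p - 1)) (by nlinarith) T hT
  have hT0 : 0 < T := by linarith
  have h3 := hB ε T hε hS hKT _ _ (by positivity) (by positivity) (hD₁ K T (by linarith) hKT)
    (hD₃ K T (by linarith) hKT)
  rw [mul_rpow_neg_rpow_mul hd₁ hT0] at h3
  rw [div_mul_eq_mul_div, div_le_iff₀ (by positivity), sub_eq_add_neg _ b, Real.rpow_add hT0] at h2
  linarith

/-- Used for a > 0, where the primitive is bounded: A is the fixed increment over [K, 2K], so only B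
and D depend on T. -/
lemma lifespan_interior_rpow_of_pos (hp : 1 < p) (hK : 1 ≤ K) (hC : 0 < C)
    (h : InteriorBound p a b K C Sol) (hab : 0 < -a - b) :
    ∃ C' : ℝ, 0 < C' ∧ ∀ ε, 0 < ε → ε ≤ 1 → ∀ T,
      C' * ε ^ (-(p * (p - 1) / (-a - b))) ≤ T → ¬ Sol ε T := by
  obtain ⟨d₁, hd₁, hD₁⟩ := exists_rpowPrimitive_doubling a
  obtain ⟨d₂, hd₂, hB⟩ := scale_bound_of_interior hK h
  obtain ⟨d₃, hd₃, hD₃⟩ := exists_le_rpowPrimitive_sub b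
  have hA : 0 < d₁ * K ^ (-a) := by positivity
  obtain ⟨C', hC', h'⟩ := exists_rpow_threshold (4 * K) hab
    (show 0 < C / ((d₁ * K ^ (-a)) ^ (p - 1) * d₂ * d₃) by positivity)
  refine ⟨C', hC', fun ε hε hε1 T hT hS => ?_⟩
  obtain ⟨hKT, h2⟩ := h' ε hε hε1 (p * (p - 1)) (by nlinarith) T hT
  have hT0 : 0 < T := by linarith
  have h3 := hB ε T hε hS hKT (d₁ * K ^ (-a)) _ hA (by positivity)
    (by
      rw [← hD₁ K (by linarith)]
      linarith [rpowPrimitive_mono a (show 0 < 2 * K by linarith) (show 2 * K ≤ T / 2 by linarith)])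
    (hD₃ K T (by linarith) hKT)
  rw [div_mul_eq_mul_div, div_le_iff₀ (by positivity), sub_eq_add_neg _ b, Real.rpow_add hT0] at h2
  linarith

end lifespan

/-! ### Assembly according to the signs of a, b and a + b -/

theorem theorem1p5 (p a b R : ℝ) (hp : 1 < p) (hR : 1 < R) (f : ℝ → ℝ)
    (hf : ContDiff ℝ 2 f) (hsupp : tsupport f ⊆ {x : ℝ | |x| ≤ R})
    (hf_nonneg : ∀ x, 0 ≤ f x) (hf_ne : ∃ x, f x ≠ 0) :
    ∃ ε₅ : ℝ, 0 < ε₅ ∧ ∃ C : ℝ, 0 < C ∧ ∀ ε : ℝ, 0 < ε → ε ≤ ε₅ → ∀ T : ℝ,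
      ((a = 0 ∧ 0 < b ∧ Real.exp (C * ε ^ (-(p - 1))) ≤ T) ∨
       (a + b = 0 ∧ 0 < a ∧ Real.exp (C * ε ^ (-(p * (p - 1)))) ≤ T) ∨
       (a = 0 ∧ b = 0 ∧ Real.exp (C * ε ^ (-(p * (p - 1) / (p + 1)))) ≤ T) ∨
       (a < 0 ∧ 0 < b ∧ C * ε ^ (-((p - 1) / (-a))) ≤ T) ∨
       (a < 0 ∧ b = 0 ∧ psi1Inv p a (C * ε ^ (-(p * (p - 1)))) ≤ T) ∨
       (a < 0 ∧ b < 0 ∧ C * ε ^ (-(p * (p - 1) / (-(p * a) - b))) ≤ T) ∨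
       (a = 0 ∧ b < 0 ∧ psi2Inv p b (C * ε ^ (-(p * (p - 1)))) ≤ T) ∨
       (a + b < 0 ∧ 0 < a ∧ C * ε ^ (-(p * (p - 1) / (-a - b))) ≤ T)) →
      ¬ ∃ u : ℝ × ℝ → ℝ, IsClassicalSolution p a b ε f (fun _ => 0) T u := by
  obtain ⟨K, ηm, ηp, δ, k, hK, -, hη, hηK, hδ, hk, hsol⟩ := exists_nullGain p a b hp
    (hf.differentiable (by norm_num)) hsupp hf_nonneg hf_ne
  let Sol : ℝ → ℝ → Prop := fun ε T =>
    ∃ u : ℝ × ℝ → ℝ, IsClassicalSolution p a b ε f (fun _ => 0) T u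
  obtain ⟨C₁, hC₁, h₁⟩ := exists_strip_bound (a := a) (b := b) hp hK hη hηK hδ hk
  obtain ⟨C₂, hC₂, h₂⟩ := exists_interior_bound (a := a) (b := b) hp hK hη hηK hδ hk
  have hstrip : ∀ ε T, 0 < ε → Sol ε T → K < T →
      rpowPrimitive a T - rpowPrimitive a K < C₁ * ε ^ (-(p - 1)) :=
    fun ε T hε ⟨u, hu⟩ => h₁ ε T _ hε (hsol ε T u hε hu)
  have hint : InteriorBound p a b K C₂ Sol := fun ε T hε hS =>
    let ⟨u, hu⟩ := hS
    h₂ ε T _ hε (hsol ε T u hε hu)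
  -- ε ≤ 1 is the only smallness used: it lets fixed constants be absorbed into multiples of ε^(-Q).
  refine ⟨1, one_pos, ?_⟩
  rcases lt_trichotomy a 0 with ha | ha | ha
  · rcases lt_trichotomy b 0 with hb | hb | hb
    · obtain ⟨C, hC, h⟩ := lifespan_interior_rpow hp hK hC₂ hint (by nlinarith)
      refine ⟨C, hC, fun ε hε hε1 T hT => h ε hε hε1 T ?_⟩
      rcases hT with h | h | h | h | h | h | h | h <;> first | exact h.2.2 | linarith [h.1, h.2.1]
    · obtain ⟨C, hC, h⟩ := lifespan_psi1 hp hK hC₂ hint ha hb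
      refine ⟨C, hC, fun ε hε hε1 T hT => h ε hε hε1 T ?_⟩
      rcases hT with h | h | h | h | h | h | h | h <;> first | exact h.2.2 | linarith [h.1, h.2.1]
    · obtain ⟨C, hC, h⟩ := lifespan_strip_rpow hp hK hC₁ ha hstrip
      refine ⟨C, hC, fun ε hε hε1 T hT => h ε hε hε1 T ?_⟩
      rcases hT with h | h | h | h | h | h | h | h <;> first | exact h.2.2 | linarith [h.1, h.2.1]
  · rcases lt_trichotomy b 0 with hb | hb | hb
    · obtain ⟨C, hC, h⟩ := lifespan_psi2 hp hK hC₂ hint ha hb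
      refine ⟨C, hC, fun ε hε hε1 T hT => h ε hε hε1 T ?_⟩
      rcases hT with h | h | h | h | h | h | h | h <;> first | exact h.2.2 | linarith [h.1, h.2.1]
    · subst ha hb
      obtain ⟨C, hC, h⟩ := lifespan_interior_exp hp hK hC₂ hint
      refine ⟨C, hC, fun ε hε hε1 T hT => h ε hε hε1 T ?_⟩
      rcases hT with h | h | h | h | h | h | h | h <;> first | exact h.2.2 | linarith [h.1, h.2.1]
    · subst ha
      obtain ⟨C, hC, h⟩ := lifespan_strip_exp hp hK hC₁ hstrip
      refine ⟨C, hC, fun ε hε hε1 T hT => h ε hε hε1 T ?_⟩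
      rcases hT with h | h | h | h | h | h | h | h <;> first | exact h.2.2 | linarith [h.1, h.2.1]
  · rcases lt_trichotomy (a + b) 0 with hab | hab | hab
    · obtain ⟨C, hC, h⟩ := lifespan_interior_rpow_of_pos hp hK hC₂ hint (by linarith)
      refine ⟨C, hC, fun ε hε hε1 T hT => h ε hε hε1 T ?_⟩
      rcases hT with h | h | h | h | h | h | h | h <;> first | exact h.2.2 | linarith [h.1, h.2.1]
    · obtain ⟨C₃, hC₃, h₃⟩ := exists_scale_invariant_bound hp hK hη hηK hδ hk hab
      obtain ⟨C, hC, h⟩ := lifespan_scale_invariant (Sol := Sol) hp hK hC₃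
        fun ε T hε ⟨u, hu⟩ => h₃ ε T _ hε (hsol ε T u hε hu)
      refine ⟨C, hC, fun ε hε hε1 T hT => h ε hε hε1 T ?_⟩
      rcases hT with h | h | h | h | h | h | h | h <;> first | exact h.2.2 | linarith [h.1, h.2.1]
    -- For a > 0 and a + b > 0 no alternative applies, so the claim is vacuous.
    · refine ⟨1, one_pos, fun ε hε hε1 T hT => ?_⟩
      rcases hT with h | h | h | h | h | h | h | h <;> linarith [h.1, h.2.1]
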